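/- **Setting.** Let $M$ be a (Hausdorff) $\mathcal C^\infty$ Banach manifold modelled on a real Banach space $\mathrm B$. A *strong sub-Riemannian structure* $(\mathcal H,\xi,g)$ on $M$ consists of a smooth vector bundle $\mathcal H\to M$ whose typical fiber is a Banach space $\mathrm H$, a smooth vector bundle morphism $\xi:\mathcal H\to TM$, and a smooth family $g=(g_q)_{q\in M}$ of positive definite symmetric bilinear forms on the fibers $\mathcal H_q$, such that for every $q$ the topology defined by the norm $\sqrt{g_q(u,u)}$ is the topology of $\mathcal H_q$. A *horizontal system* on $[a,b]$ is a pair $(q,u)$ with $u(t)\in\mathcal H_{q(t)}$, with $q$ continuous and of Sobolev class $H^1$ in charts, $u$ of class $L^2$ in trivializations, and $\dot q(t)=\xi_{q(t)}u(t)$ for almost every $t$. Its length on $[a,b]$ is $L=\int_a^b\sqrt{g_{q(t)}(u(t),u(t))}\,dt$, and $d(x,y)\in[0,\infty]$ is the infimum of the lengths of the horizontal systems on $[0,1]$ with $q(0)=x$ and $q(1)=y$. A pair $(q,u)$ on an interval $J$ is a *geodesic* if it is a horizontal system on every compact subinterval of $J$ and every $t\in J$ has a neighbourhood in $J$ such that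 $L((q,u)|_{[t_0,t_1]})=d(q(t_0),q(t_1))$ for all $t_0\le t_1$ in that neighbourhood. On $T^*M$ let $\omega$ be the canonical weak symplectic form, given in canonical coordinates by $\omega(\delta q,\delta p;\delta q',\delta p')=\delta p'(\delta q)-\delta p(\delta q')$. A symplectic gradient of $f:T^*M\to\mathbb R$ at $z$ is a vector $\nabla^\omega f(z)\in T_zT^*M$ with $df_z=\omega_z(\nabla^\omega f(z),\cdot)$; in canonical coordinates it reads $(\partial_pf,-\partial_qf)$. For $q\in M$, $p\in T_q^*M$, $u\in\mathcal H_q$ put $H^1(q,p,u)=p(\xi_qu)-\frac12g_q(u,u)$. **Theorem (Hamiltonian geodesic flow: strong case).** Let $(\mathcal H,\xi,g)$ be a strong sub-Riemannian structure on $M$. 1. For every $(q,p)\in T^*M$ there is a unique $u(q,p)\in\mathcal H_q$ with $\xi_q^*p=g_q(u(q,p),\cdot)$. Hence the normal Hamiltonian $$h(q,p)=\tfrac12\,g_q(u(q,p),u(q,p))=H^1(q,p,u(q,p))=\max_{u\in\mathcal H_q}H^1(q,p,u)$$ is well defined on all of $T^*M$. It is smooth and has a unique symplectic gradient $\nabla^\omega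 h(q,p)$ at every point of $T^*M$. 2. For every $(q_0,p_0)\in T^*M$ the Hamiltonian equation $$(\dot q(t),\dot p(t))=\nabla^\omega h(q(t),p(t)),\qquad (q(0),p(0))=(q_0,p_0),$$ has a unique maximal solution. It is defined on an open interval, and every solution on an interval containing $0$ is a restriction of it. 3. For every solution $t\mapsto(q(t),p(t))$ of the Hamiltonian equation on an interval $J$, the projection $q(\cdot)$ is a geodesic, with control $u(t)=u(q(t),p(t))$. -/

import Mathlib

open Set MeasureTheory Topology Bundle Filter
open scoped Manifold ContDiff ENNReal

noncomputable section

namespace SubRiem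

universe uB uF uM uE

/-- The cotangent bundle `T*M` of a manifold `M` modelled on the Banach space `B`: the fibre at `q`
is the topological dual of `T_q M`. It carries Mathlib's smooth vector bundle structure, whose
charts are the canonical charts `(q, p) ↦ (ψ q, p ∘ (dψ_q)⁻¹)`, with `ψ` a chart of `M`. -/
abbrev CotangentBundle (B : Type uB) [NormedAddCommGroup B] [NormedSpace ℝ B]
    (M : Type uM) [TopologicalSpace M] [ChartedSpace B M] [IsManifold 𝓘(ℝ, B) ∞ M] :
    Type (max uM uB) :=
  TotalSpace (B →L[ℝ] ℝ) (fun q : M => TangentSpace 𝓘(ℝ, B) q →L[ℝ] Bundle.Trivial M ℝ q)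

/-- The model with corners of `T*M`, a manifold modelled on `B × B*`. -/
abbrev cotangentModel (B : Type uB) [NormedAddCommGroup B] [NormedSpace ℝ B] :
    ModelWithCorners ℝ (B × (B →L[ℝ] ℝ)) (ModelProd B (B →L[ℝ] ℝ)) :=
  𝓘(ℝ, B).prod 𝓘(ℝ, B →L[ℝ] ℝ)

section Symplectic

variable {B : Type uB} [NormedAddCommGroup B] [NormedSpace ℝ B]
  {M : Type uM} [TopologicalSpace M] [ChartedSpace B M] [IsManifold 𝓘(ℝ, B) ∞ M]

/-- The canonical weak symplectic form of `T*M`. A vector tangent to `T*M` at `z` is by definition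
the pair `(δq, δp)` of its components in the canonical chart centred at `z`, and in canonical
coordinates `ω(δq, δp; δq', δp') = δp'(δq) - δp(δq')`. -/
def canonicalForm (z : CotangentBundle B M) (X Y : TangentSpace (cotangentModel B) z) : ℝ :=
  (Y : B × (B →L[ℝ] ℝ)).2 (X : B × (B →L[ℝ] ℝ)).1
    - (X : B × (B →L[ℝ] ℝ)).2 (Y : B × (B →L[ℝ] ℝ)).1

/-- `X` is a symplectic gradient of `f` at `z`: `df_z = ω_z(X, ·)`. -/
def IsSymplecticGradient (f : CotangentBundle B M → ℝ) (z : CotangentBundle B M)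
    (X : TangentSpace (cotangentModel B) z) : Prop :=
  MDifferentiableAt (cotangentModel B) 𝓘(ℝ, ℝ) f z ∧
    ∀ Y : TangentSpace (cotangentModel B) z,
      mfderiv (cotangentModel B) 𝓘(ℝ, ℝ) f z Y = canonicalForm z X Y

/-- The symplectic gradient `∇^ω f` (an arbitrary value where there is none). -/
def symplecticGradient (f : CotangentBundle B M → ℝ) (z : CotangentBundle B M) :
    TangentSpace (cotangentModel B) z :=
  haveI : Nonempty (TangentSpace (cotangentModel B) z) := ⟨0⟩
  Classical.epsilon (IsSymplecticGradient f z)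

end Symplectic

/-- A (weak) sub-Riemannian structure `(𝓗, ξ, g)` on the Banach manifold `M`, where `𝓗` is a smooth
vector bundle with typical fibre `F` and fibres `E q`: `ξ : 𝓗 → TM` is a smooth vector bundle
morphism and `g` is a smooth field of positive definite symmetric bilinear forms on the fibres. -/
structure SubRiemannianStructure
    (B : Type uB) [NormedAddCommGroup B] [NormedSpace ℝ B]
    (M : Type uM) [TopologicalSpace M] [ChartedSpace B M] [IsManifold 𝓘(ℝ, B) ∞ M]
    (F : Type uF) [NormedAddCommGroup F] [NormedSpace ℝ F]
    (E : M → Type uE) [TopologicalSpace (TotalSpace F E)]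
    [∀ q, TopologicalSpace (E q)] [∀ q, AddCommGroup (E q)] [∀ q, Module ℝ (E q)]
    [∀ q, IsTopologicalAddGroup (E q)] [∀ q, ContinuousSMul ℝ (E q)]
    [FiberBundle F E] [VectorBundle ℝ F E] [ContMDiffVectorBundle ∞ F E 𝓘(ℝ, B)] where
  /-- the anchor `ξ_q : 𝓗_q → T_q M` -/
  anchor (q : M) : E q →L[ℝ] TangentSpace 𝓘(ℝ, B) q
  contMDiff_anchor : ContMDiff 𝓘(ℝ, B) (𝓘(ℝ, B).prod 𝓘(ℝ, F →L[ℝ] B)) ∞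
    (fun q => TotalSpace.mk' (F →L[ℝ] B) (E := fun q => E q →L[ℝ] TangentSpace 𝓘(ℝ, B) q)
      q (anchor q))
  /-- the metric `g_q` -/
  metric (q : M) : E q →L[ℝ] E q →L[ℝ] ℝ
  contMDiff_metric : ContMDiff 𝓘(ℝ, B) (𝓘(ℝ, B).prod 𝓘(ℝ, F →L[ℝ] F →L[ℝ] ℝ)) ∞
    (fun q => TotalSpace.mk' (F →L[ℝ] F →L[ℝ] ℝ)
      (E := fun q => E q →L[ℝ] E q →L[ℝ] Bundle.Trivial M ℝ q) q (metric q))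
  metric_symm (q : M) (u v : E q) : metric q u v = metric q v u
  metric_pos (q : M) (u : E q) : u ≠ 0 → 0 < metric q u u

namespace SubRiemannianStructure

variable {B : Type uB} [NormedAddCommGroup B] [NormedSpace ℝ B]
  {M : Type uM} [TopologicalSpace M] [ChartedSpace B M] [IsManifold 𝓘(ℝ, B) ∞ M]
  {F : Type uF} [NormedAddCommGroup F] [NormedSpace ℝ F]
  {E : M → Type uE} [TopologicalSpace (TotalSpace F E)]
  [∀ q, TopologicalSpace (E q)] [∀ q, AddCommGroup (E q)] [∀ q, Module ℝ (E q)]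
  [∀ q, IsTopologicalAddGroup (E q)] [∀ q, ContinuousSMul ℝ (E q)]
  [FiberBundle F E] [VectorBundle ℝ F E] [ContMDiffVectorBundle ∞ F E 𝓘(ℝ, B)]
  (S : SubRiemannianStructure B M F E)

/-- The structure is strong: on every fibre, the topology of the norm `√(g_q(u, u))` coincides with
the topology of the fibre. -/
def IsStrong : Prop :=
  ∀ (q : M) (s : Set (E q)),
    s ∈ 𝓝 (0 : E q) ↔ ∃ ε : ℝ, 0 < ε ∧ {u : E q | √(S.metric q u u) < ε} ⊆ s

/-- The Hamiltonian `H¹(q, p, u) = p(ξ_q u) - ½ g_q(u, u)`. -/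
def preHamiltonian (z : CotangentBundle B M) (u : E z.proj) : ℝ :=
  z.snd (S.anchor z.proj u) - 1 / 2 * S.metric z.proj u u

/-- `u ∈ 𝓗_q` solves `ξ_q^* p = g_q(u, ·)`, i.e. `∂_u H¹(q, p, u) = 0`. -/
def IsNormalControl (z : CotangentBundle B M) (u : E z.proj) : Prop :=
  ∀ v : E z.proj, z.snd (S.anchor z.proj v) = S.metric z.proj u v

/-- The solution `u(q, p)` of `ξ_q^* p = g_q(u, ·)` (an arbitrary value where there is none). -/
def normalControl (z : CotangentBundle B M) : E z.proj :=
  haveI : Nonempty (E z.proj) := ⟨0⟩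
  Classical.epsilon (S.IsNormalControl z)

/-- The normal Hamiltonian `h(q, p) = ½ g_q(u(q, p), u(q, p))`. -/
def normalHamiltonian (z : CotangentBundle B M) : ℝ :=
  1 / 2 * S.metric z.proj (S.normalControl z) (S.normalControl z)

/-- `c = (q, u)` is a horizontal system on `[a, b]`: the trajectory `q` is continuous and, over every
subinterval `[s, t]` on which it stays in the domain of a chart `ψ` of `M` (respectively of a local
trivialization of `𝓗`), the control `u` is of class `L²` in the trivialization, and `ψ ∘ q` is of
Sobolev class `H¹` with weak derivative the `L²` function `r ↦ dψ(ξ_{q(r)} u(r))`. In other words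
`(q, u)` is of class `H¹ × L²` and `q̇(r) = ξ_{q(r)} u(r)` for almost every `r`. -/
structure IsHorizontalOn (c : ℝ → TotalSpace F E) (a b : ℝ) : Prop where
  continuousOn : ContinuousOn (fun t => (c t).proj) (Icc a b)
  memLp_control : ∀ (x : M) (s t : ℝ), a ≤ s → s ≤ t → t ≤ b →
    (∀ r ∈ Icc s t, (c r).proj ∈ (trivializationAt F E x).baseSet) →
    MemLp (fun r => (trivializationAt F E x (c r)).2) 2 (volume.restrict (Icc s t))
  memLp_velocity : ∀ (x : M) (s t : ℝ), a ≤ s → s ≤ t → t ≤ b →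
    (∀ r ∈ Icc s t, (c r).proj ∈ (chartAt B x).source) →
    MemLp (fun r => (mfderiv 𝓘(ℝ, B) 𝓘(ℝ, B) (chartAt B x) (c r).proj
      (S.anchor (c r).proj (c r).snd) : B)) 2 (volume.restrict (Icc s t))
  integral_velocity : ∀ (x : M) (s t : ℝ), a ≤ s → s ≤ t → t ≤ b →
    (∀ r ∈ Icc s t, (c r).proj ∈ (chartAt B x).source) →
    chartAt B x (c t).proj - chartAt B x (c s).proj =
      ∫ r in s..t, (mfderiv 𝓘(ℝ, B) 𝓘(ℝ, B) (chartAt B x) (c r).proj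
        (S.anchor (c r).proj (c r).snd) : B)

/-- The length `∫_a^b √(g_q(u, u)) dt` of a system `c = (q, u)`. -/
def length (c : ℝ → TotalSpace F E) (a b : ℝ) : ℝ≥0∞ :=
  ∫⁻ t in Icc a b, ENNReal.ofReal √(S.metric (c t).proj (c t).snd (c t).snd)

/-- The sub-Riemannian distance: the infimum of the lengths of the horizontal systems on `[0, 1]`
that join the two points (`∞` if there are none). -/
def dist (q₀ q₁ : M) : ℝ≥0∞ :=
  ⨅ (c : ℝ → TotalSpace F E)
    (_ : S.IsHorizontalOn c 0 1 ∧ (c 0).proj = q₀ ∧ (c 1).proj = q₁), S.length c 0 1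

/-- `c = (q, u)` is a geodesic on the interval `J`: it is horizontal (on every compact subinterval),
and for `t₀ ≤ t₁` in `J` close enough to each other (locally uniformly in `J`) its length on
`[t₀, t₁]` is the distance between `q(t₀)` and `q(t₁)`. -/
def IsGeodesicOn (c : ℝ → TotalSpace F E) (J : Set ℝ) : Prop :=
  (∀ a b : ℝ, a ≤ b → Icc a b ⊆ J → S.IsHorizontalOn c a b) ∧
    ∀ t ∈ J, ∃ ε : ℝ, 0 < ε ∧ ∀ t₀ ∈ J, ∀ t₁ ∈ J, t - ε < t₀ → t₀ ≤ t₁ → t₁ < t + ε →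
      S.length c t₀ t₁ = S.dist (c t₀).proj (c t₁).proj

/-- `γ = (q, p) : J → T*M` solves the normal Hamiltonian equation `γ̇ = ∇^ω h(γ)` on the
interval `J` (open or not, with one-sided derivatives at the end points that belong to `J`). -/
def IsHamiltonianSolution (γ : ℝ → CotangentBundle B M) (J : Set ℝ) : Prop :=
  J.OrdConnected ∧ IsMIntegralCurveOn γ (symplecticGradient S.normalHamiltonian) J

/-- `γ : J → T*M` is a maximal solution with `γ(0) = z₀`: it is no proper restriction of another
solution. -/
def IsMaximalSolution (z₀ : CotangentBundle B M) (γ : ℝ → CotangentBundle B M) (J : Set ℝ) :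
    Prop :=
  S.IsHamiltonianSolution γ J ∧ 0 ∈ J ∧ γ 0 = z₀ ∧
    ∀ (γ' : ℝ → CotangentBundle B M) (J' : Set ℝ), S.IsHamiltonianSolution γ' J' →
      J ⊆ J' → EqOn γ' γ J → J' = J

end SubRiemannianStructure

end SubRiem

end

set_option maxSynthPendingDepth 3

noncomputable section

namespace SubRiem

/-! In a chart of $M$ and a trivialization of $\mathcal H$, the structure becomes a pair of smooth
operator-valued maps $\xi$, $g$ on an open subset of $\mathrm B$ (`isLocalModel`). Strongness makes
$g_x$ coercive, and the Riesz theorem makes it onto the dual. So $g_x$ is invertible,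
$u=g_x^{-1}(p\circ\xi_x)$ is smooth in $(x,p)$, and so is $h$. The form $\omega$ is only weak:
$\partial_ph$ lies a priori in the bidual of $\mathrm B$. But $h$ is quadratic in $p$ and
$\partial_ph(\delta)=\delta(\xi u)$, so it is represented by the vector $\xi u$ and the symplectic
gradient exists.

`canonicalForm` at $z$ is read in the chart centred at $z$, hence in a chart that moves with $z$.
The invariance of $\omega$ under cotangent lifts (`canonicalForm_tangentCoordChange`) gives the
gradient in one fixed chart near each point, and with it its regularity. The existence and
uniqueness theorem for integral curves then yields local solutions, and gluing yields the maximal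
one (`exists_maximal_isMIntegralCurveOn`).

The heart of the geodesic property is `sqrt_energy_mul_le_integral`. Instead of a Hamilton–Jacobi
solution, a linear function serves as an approximate calibration. Let $(q,p)$ be an extremal of
energy $E$ on an interval of length $T$, and let $x$ be a competitor with the same end points and
length $\ell$. Re-time $x$ by $\tau$ so that it takes the same time $T$ with speed at most
$\kappa\approx\ell/T$. The function $p(\tau)(x-q(\tau))$ vanishes at both ends, so its derivative
has integral zero. Completing the square and expanding $h(\cdot,p)$ to second order at $q$ bounds
this derivative by the main terms, whose integral is $\kappa\ell/2-TE$, minus a gain quadratic in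
the deviation of the control, plus a loss quadratic in the deviation $x-q(\tau)$. The second
deviation is controlled by the first, so for small $T$ the gain absorbs the loss, and
$2ET^2\le\ell^2$ follows.

The competitor need not stay in the chart. However, a horizontal curve that leaves a chart ball has
length bounded below (`IsHorizontalOn.mem_ball_of_length_lt`), which exceeds the length of a short
extremal. -/

/-! ### Integrals along curves with an integrable weak derivative. -/

theorem _root_.ContinuousOn.aestronglyMeasurable_Icc {Z : Type*} [TopologicalSpace Z]
    [TopologicalSpace.PseudoMetrizableSpace Z] {f : ℝ → Z} {a b : ℝ}
    (hf : ContinuousOn f (Icc a b)) : AEStronglyMeasurable f (volume.restrict (Icc a b)) :=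
  hf.aestronglyMeasurable_of_isCompact isCompact_Icc measurableSet_Icc

theorem _root_.ContinuousOn.integrableOn_clm_apply {V W : Type*} [NormedAddCommGroup V]
    [NormedSpace ℝ V] [NormedAddCommGroup W] [NormedSpace ℝ W] {L : ℝ → V →L[ℝ] W} {v : ℝ → V}
    {a b : ℝ} (hL : ContinuousOn L (Icc a b)) (hv : IntegrableOn v (Icc a b)) :
    IntegrableOn (fun s => L s (v s)) (Icc a b) := by
  obtain ⟨C, hC⟩ := isCompact_Icc.exists_bound_of_continuousOn hL
  refine (hv.norm.const_mul C).mono'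
    (isBoundedBilinearMap_apply.continuous.comp_aestronglyMeasurable
      (hL.aestronglyMeasurable_Icc.prodMk hv.aestronglyMeasurable)) ?_
  filter_upwards [ae_restrict_mem measurableSet_Icc] with s hs
  exact ((L s).le_opNorm _).trans (mul_le_mul_of_nonneg_right (hC s hs) (norm_nonneg _))

theorem _root_.ContinuousOn.aestronglyMeasurable_sqrt_apply₂ {V : Type*} [NormedAddCommGroup V]
    [NormedSpace ℝ V] {g : ℝ → V →L[ℝ] V →L[ℝ] ℝ} {v : ℝ → V} {a b : ℝ}
    (hg : ContinuousOn g (Icc a b)) (hv : AEStronglyMeasurable v (volume.restrict (Icc a b))) :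
    AEStronglyMeasurable (fun s => √(g s (v s) (v s))) (volume.restrict (Icc a b)) := by
  have h1 : AEStronglyMeasurable (fun r => g r (v r)) (volume.restrict (Icc a b)) :=
    isBoundedBilinearMap_apply.continuous.comp_aestronglyMeasurable
      (hg.aestronglyMeasurable_Icc.prodMk hv)
  exact Real.continuous_sqrt.comp_aestronglyMeasurable
    (isBoundedBilinearMap_apply.continuous.comp_aestronglyMeasurable (h1.prodMk hv))

theorem _root_.ContinuousOn.integrableOn_sqrt_apply₂ {V : Type*} [NormedAddCommGroup V]
    [NormedSpace ℝ V] {g : ℝ → V →L[ℝ] V →L[ℝ] ℝ} {v : ℝ → V} {a b : ℝ}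
    (hg : ContinuousOn g (Icc a b)) (hv : IntegrableOn v (Icc a b)) :
    IntegrableOn (fun s => √(g s (v s) (v s))) (Icc a b) := by
  obtain ⟨K, hK⟩ := isCompact_Icc.exists_bound_of_continuousOn hg
  refine (hv.norm.const_mul √K).mono' (hg.aestronglyMeasurable_sqrt_apply₂ hv.1) ?_
  filter_upwards [ae_restrict_mem measurableSet_Icc] with r hr
  have hK0 : 0 ≤ K := (norm_nonneg _).trans (hK r hr)
  rw [Real.norm_of_nonneg (Real.sqrt_nonneg _), ← Real.sqrt_sq (norm_nonneg (v r)),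
    ← Real.sqrt_mul hK0]
  refine Real.sqrt_le_sqrt ((le_abs_self _).trans ?_)
  calc |g r (v r) (v r)| ≤ ‖g r‖ * ‖v r‖ * ‖v r‖ := (g r).le_opNorm₂ _ _
    _ ≤ K * ‖v r‖ ^ 2 := by rw [mul_assoc, ← sq]; gcongr; exact hK r hr

/-- Chain rule in integrated form along a curve with an integrable weak derivative. -/
theorem sub_eq_integral_of_hasFDerivAt {V W : Type*} [NormedAddCommGroup V] [NormedSpace ℝ V]
    [CompleteSpace V] [NormedAddCommGroup W] [NormedSpace ℝ W] [CompleteSpace W]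
    {y v : ℝ → V} {a b : ℝ} (hab : a ≤ b) (hv : IntervalIntegrable v volume a b)
    (hy : ∀ s ∈ Icc a b, ∀ t ∈ Icc a b, y t - y s = ∫ r in s..t, v r)
    (hyc : ContinuousOn y (Icc a b))
    {Φ : V → W} {L : ℝ → V →L[ℝ] W} (hΦ : ∀ t ∈ Icc a b, HasFDerivAt Φ (L t) (y t))
    (hL : ContinuousOn L (Icc a b)) :
    IntervalIntegrable (fun s => L s (v s)) volume a b ∧
      Φ (y b) - Φ (y a) = ∫ s in a..b, L s (v s) := by
  have hLv : IntervalIntegrable (fun s => L s (v s)) volume a b := by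
    rw [intervalIntegrable_iff_integrableOn_Icc_of_le hab] at hv ⊢
    exact hL.integrableOn_clm_apply hv
  refine ⟨hLv, ?_⟩
  have sub : ∀ {s t : ℝ}, s ∈ Icc a b → t ∈ Icc a b → uIcc s t ⊆ uIcc a b := fun {s t} hs ht => by
    rw [uIcc_of_le hab]; exact uIcc_subset_Icc hs ht
  have ha : a ∈ Icc a b := left_mem_Icc.2 hab
  set D : ℝ → W := fun t => Φ (y t) - Φ (y a) - ∫ s in a..t, L s (v s) with hD
  set K : ℝ → ℝ := fun t => ∫ s in a..t, ‖v s‖ with hK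
  have hΦc : ContinuousOn (fun t => Φ (y t)) (Icc a b) := fun t ht =>
    (hΦ t ht).continuousAt.comp_continuousWithinAt (hyc t ht)
  have hDc : ContinuousOn D (Icc a b) := (hΦc.sub continuousOn_const).sub (by
    simpa [uIcc_of_le hab] using
      intervalIntegral.continuousOn_primitive_interval' hLv left_mem_uIcc)
  have hKc : ContinuousOn K (Icc a b) := by
    simpa [uIcc_of_le hab] using
      intervalIntegral.continuousOn_primitive_interval' hv.norm left_mem_uIcc
  -- Continuous induction on $[a,b]$ with slack $\varepsilon$, as in the mean value inequality, but
  -- with $\int\|v\|$ in the role of time. No almost everywhere differentiability of $y$ is used.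
  have key : ∀ ε > 0, ‖D b‖ ≤ ε * K b := by
    intro ε hε
    have : Icc a b ⊆ {t | ‖D t‖ ≤ ε * K t} := by
      refine IsClosed.Icc_subset_of_forall_exists_gt ?_ ?_ ?_
      · rw [inter_comm]
        exact isClosed_Icc.isClosed_le hDc.norm (continuousOn_const.mul hKc)
      · simp [hD, hK]
      · rintro s ⟨hs, hsa, hsb⟩ z hz
        have hsI : s ∈ Icc a b := ⟨hsa, hsb.le⟩
        have h1 : ∀ᶠ t in 𝓝[Icc a b] s,
            ‖Φ (y t) - Φ (y s) - L s (y t - y s)‖ ≤ ε / 2 * ‖y t - y s‖ :=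
          (hyc s hsI).eventually ((hΦ s hsI).isLittleO.def (half_pos hε))
        have h2 : ∀ᶠ t in 𝓝[Icc a b] s, ‖L t - L s‖ ≤ ε / 2 := by
          have := (hL s hsI).eventually (Metric.closedBall_mem_nhds (L s) (half_pos hε))
          filter_upwards [this] with t ht
          simpa [dist_eq_norm] using ht
        obtain ⟨δ, hδ, hball⟩ := Metric.mem_nhdsWithin_iff.1 (h1.and h2)
        set t := min (min z b) (s + δ / 2) with ht
        have hst : s < t := lt_min (lt_min hz hsb) (by linarith)
        have htb : t ≤ b := (min_le_left _ _).trans (min_le_right _ _)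
        have htI : t ∈ Icc a b := ⟨hsa.trans hst.le, htb⟩
        have hgood : ∀ r ∈ Icc s t, ‖Φ (y r) - Φ (y s) - L s (y r - y s)‖ ≤ ε / 2 * ‖y r - y s‖
            ∧ ‖L r - L s‖ ≤ ε / 2 := by
          intro r hr
          refine hball ⟨?_, hsa.trans hr.1, hr.2.trans htb⟩
          rw [Metric.mem_ball, Real.dist_eq, abs_of_nonneg (by linarith [hr.1])]
          have : t ≤ s + δ / 2 := min_le_right _ _
          linarith [hr.2]
        refine ⟨t, ?_, hst, (min_le_left _ _).trans (min_le_left _ _)⟩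
        have ivs : IntervalIntegrable v volume s t := hv.mono_set (sub hsI htI)
        have iva : IntervalIntegrable v volume a s := hv.mono_set (sub ha hsI)
        have iLs : IntervalIntegrable (fun r => L r (v r)) volume s t := hLv.mono_set (sub hsI htI)
        have iLa : IntervalIntegrable (fun r => L r (v r)) volume a s := hLv.mono_set (sub ha hsI)
        have eK : K t = K s + ∫ r in s..t, ‖v r‖ :=
          (intervalIntegral.integral_add_adjacent_intervals iva.norm ivs.norm).symm
        have hyt : y t - y s = ∫ r in s..t, v r := hy s hsI t htI
        have iLc : IntervalIntegrable (fun r => L s (v r)) volume s t := by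
          rw [intervalIntegrable_iff] at ivs ⊢
          exact (L s).integrable_comp ivs
        have eL : ∫ r in s..t, (L r - L s) (v r) = (∫ r in s..t, L r (v r)) - L s (y t - y s) := by
          rw [hyt, ← ContinuousLinearMap.intervalIntegral_comp_comm _ ivs,
            ← intervalIntegral.integral_sub iLs iLc]
          rfl
        -- The increment of the defect splits into the Taylor remainder of $\Phi$ at $y(s)$ and the
        -- variation of $L$; each costs at most $\varepsilon/2$ times $\int_s^t\|v\|$.
        have eD : D t = D s + ((Φ (y t) - Φ (y s) - L s (y t - y s))
            - ∫ r in s..t, (L r - L s) (v r)) := by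
          have := intervalIntegral.integral_add_adjacent_intervals iLa iLs
          simp only [hD, eL, ← this]
          abel
        have b1 : ‖y t - y s‖ ≤ ∫ r in s..t, ‖v r‖ := by
          rw [hyt]; exact intervalIntegral.norm_integral_le_integral_norm hst.le
        have b2 : ‖∫ r in s..t, (L r - L s) (v r)‖ ≤ ε / 2 * ∫ r in s..t, ‖v r‖ := by
          rw [← intervalIntegral.integral_const_mul]
          refine intervalIntegral.norm_integral_le_of_norm_le hst.le ?_ (ivs.norm.const_mul _)
          refine Eventually.of_forall fun r hr => ?_
          exact ((L r - L s).le_opNorm _).trans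
            (mul_le_mul_of_nonneg_right (hgood r (Ioc_subset_Icc_self hr)).2 (norm_nonneg _))
        have b3 := (hgood t (right_mem_Icc.2 hst.le)).1
        calc ‖D t‖ ≤ ‖D s‖ + (‖Φ (y t) - Φ (y s) - L s (y t - y s)‖
              + ‖∫ r in s..t, (L r - L s) (v r)‖) := by
              rw [eD]; exact (norm_add_le _ _).trans (by gcongr; exact norm_sub_le _ _)
          _ ≤ ε * K s + (ε / 2 * (∫ r in s..t, ‖v r‖) + ε / 2 * ∫ r in s..t, ‖v r‖) := by
              gcongr
              · exact hs
              · exact b3.trans (by gcongr)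
          _ = ε * K t := by rw [eK]; ring
    exact this (right_mem_Icc.2 hab)
  have hKb : 0 ≤ K b := intervalIntegral.integral_nonneg hab fun _ _ => norm_nonneg _
  have : ‖D b‖ ≤ 0 := by
    refine le_of_forall_pos_le_add fun ε hε => ?_
    have h := key (ε / (K b + 1)) (by positivity)
    calc ‖D b‖ ≤ ε / (K b + 1) * K b := h
      _ ≤ 0 + ε := by
        rw [zero_add, div_mul_eq_mul_div, div_le_iff₀ (by positivity)]
        nlinarith
  exact sub_eq_zero.1 (norm_le_zero_iff.1 this)

/-! ### Short extremals minimize length: the estimate in coordinates. -/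

/-- Completing the square in `p(ξ u)`, with the weight `a` and the remainder
`w = a⁻¹ u - n`. -/
theorem apply_le_of_coercive {F : Type*} [NormedAddCommGroup F] [NormedSpace ℝ F]
    {g : F →L[ℝ] F →L[ℝ] ℝ} (hsymm : ∀ v w, g v w = g w v) {c : ℝ}
    (hco : ∀ v, c * ‖v‖ ^ 2 ≤ g v v) (hc : 0 ≤ c) {a κ : ℝ} (ha : 0 < a) (u n : F)
    (hκ : √(g u u) ≤ κ * a) (k : ℝ) :
    g n u ≤ κ / 2 * √(g u u) + a / 2 * g n n - c * k * (a * ‖a⁻¹ • u - n‖)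
      + a * (c * k ^ 2 / 2) := by
  have hpos : 0 ≤ g u u := (mul_nonneg hc (sq_nonneg _)).trans (hco u)
  set ρ := √(g u u) with hρ
  have hρ0 : 0 ≤ ρ := Real.sqrt_nonneg _
  have hρ2 : g u u = ρ ^ 2 := (Real.sq_sqrt hpos).symm
  set w := a⁻¹ • u - n with hw
  have hu : u = a • (w + n) := by rw [hw, sub_add_cancel, smul_inv_smul₀ ha.ne']
  have e1 : g u u = a ^ 2 * (g w w + 2 * g n w + g n n) := by
    rw [hu]; simp [hsymm w n]; ring
  have e2 : g n u = a * (g n w + g n n) := by rw [hu]; simp [mul_add]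
  have h1 : g u u ≤ κ * a * ρ := by rw [hρ2, sq]; exact mul_le_mul_of_nonneg_right hκ hρ0
  -- The quadratic gain is replaced by a tangent line in $\|w\|$: after integration only the $L^1$
  -- norm of the deviation appears, and the slope $k$ can be tuned later.
  have h2 : c * (2 * k * ‖w‖ - k ^ 2) ≤ g w w :=
    (mul_le_mul_of_nonneg_left (by nlinarith [sq_nonneg (‖w‖ - k)]) hc).trans (hco w)
  have h3 : a * (g w w + 2 * g n w + g n n) ≤ κ * ρ := by
    refine le_of_mul_le_mul_left ?_ ha
    calc a * (a * (g w w + 2 * g n w + g n n)) = g u u := by rw [e1]; ring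
      _ ≤ a * (κ * ρ) := by linarith
  have h4 := mul_le_mul_of_nonneg_left h2 ha.le
  rw [e2]
  linarith

/-- The arithmetic behind the choice of a short time interval. -/
theorem energy_mul_sq_le {T E κ ℓ η c C C₁ m J : ℝ} (hT : 0 < T) (hc : 0 < c) (hC : 0 < C)
    (hm : 0 ≤ m) (hmJ : m ≤ 2 * C * J) (hT₂ : 8 * C ^ 2 * C₁ * T ^ 2 ≤ c) (hκ : κ * T = ℓ + η)
    (h : 0 ≤ κ / 2 * ℓ - T * E - c * (m / (2 * C * T)) * J
      + T * (c * (m / (2 * C * T)) ^ 2 / 2 + C₁ * m ^ 2)) :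
    2 * E * T ^ 2 ≤ ℓ * (ℓ + η) := by
  -- With this slope, $kT\le J$ makes the gain at least $ck^2T$, while the two losses are at most
  -- $ck^2T/2$ each.
  set k := m / (2 * C * T) with hk
  have hkT : k * T ≤ J := by
    rw [hk, div_mul_eq_mul_div, div_le_iff₀ (by positivity)]
    calc m * T ≤ 2 * C * J * T := mul_le_mul_of_nonneg_right hmJ hT.le
      _ = J * (2 * C * T) := by ring
  have hk0 : 0 ≤ k := by positivity
  have e : m = 2 * C * T * k := by rw [hk]; field_simp
  have h1 : C₁ * m ^ 2 ≤ c * k ^ 2 / 2 := by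
    calc C₁ * m ^ 2 = 8 * C ^ 2 * C₁ * T ^ 2 * k ^ 2 / 2 := by rw [e]; ring
      _ ≤ c * k ^ 2 / 2 := by gcongr
  have h2 : c * k * (k * T) ≤ c * k * J := mul_le_mul_of_nonneg_left hkT (by positivity)
  have h3 : T * (C₁ * m ^ 2) ≤ T * (c * k ^ 2 / 2) := mul_le_mul_of_nonneg_left h1 hT.le
  have h4 : T * E ≤ κ / 2 * ℓ := by linarith
  have h5 := mul_le_mul_of_nonneg_left h4 hT.le
  calc 2 * E * T ^ 2 = 2 * (T * (T * E)) := by ring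
    _ ≤ 2 * (T * (κ / 2 * ℓ)) := by linarith
    _ = ℓ * (κ * T) := by ring
    _ = ℓ * (ℓ + η) := by rw [hκ]

set_option synthInstance.maxHeartbeats 100000 in
set_option maxHeartbeats 1000000 in
/-- Short normal extremals minimize the length, in coordinates: a curve `x` with velocity
`ξ_x u` that has the same end points as the extremal `(q, p)` on a short interval `[t₀, t₁]` is at
least as long. -/
theorem sqrt_energy_mul_le_integral
    {B F : Type*} [NormedAddCommGroup B] [NormedSpace ℝ B] [CompleteSpace B]
    [NormedAddCommGroup F] [NormedSpace ℝ F] [CompleteSpace F]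
    {ξ : B → F →L[ℝ] B} {g : B → F →L[ℝ] F →L[ℝ] ℝ} {n : B × (B →L[ℝ] ℝ) → F} {O : Set B}
    (hξc : ContinuousOn ξ O) (hgc : ContinuousOn g O) (hnc : ContinuousOn n (O ×ˢ univ))
    (hsymm : ∀ x ∈ O, ∀ v w, g x v w = g x w v)
    (hn : ∀ x ∈ O, ∀ (p : B →L[ℝ] ℝ) (v : F), p (ξ x v) = g x (n (x, p)) v)
    {c C C₁ E t₀ t₁ : ℝ} (hc : 0 < c) (hC : 0 < C) (hC₁ : 0 ≤ C₁)
    (hco : ∀ x ∈ O, ∀ v, c * ‖v‖ ^ 2 ≤ g x v v) (hξ : ∀ x ∈ O, ‖ξ x‖ ≤ C)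
    {q q' : ℝ → B} {p p' : ℝ → B →L[ℝ] ℝ} (ht : t₀ < t₁)
    (hq : ∀ t ∈ Icc t₀ t₁, HasDerivAt q (q' t) t) (hp : ∀ t ∈ Icc t₀ t₁, HasDerivAt p (p' t) t)
    (hq'c : ContinuousOn q' (Icc t₀ t₁)) (hp'c : ContinuousOn p' (Icc t₀ t₁))
    (hlip : ∀ t ∈ Icc t₀ t₁, ∀ x ∈ O, ‖ξ x (n (x, p t)) - q' t‖ ≤ C * ‖x - q t‖)
    (hE : ∀ t ∈ Icc t₀ t₁, p t (q' t) = 2 * E)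
    (htay : ∀ t ∈ Icc t₀ t₁, ∀ x ∈ O, 1 / 2 * g x (n (x, p t)) (n (x, p t)) ≤
      E - p' t (x - q t) + C₁ * ‖x - q t‖ ^ 2)
    (hT₁ : C * (t₁ - t₀) ≤ 1 / 2) (hT₂ : 8 * C ^ 2 * C₁ * (t₁ - t₀) ^ 2 ≤ c)
    {x : ℝ → B} {u : ℝ → F} (hxO : ∀ s ∈ Icc (0 : ℝ) 1, x s ∈ O)
    (hxc : ContinuousOn x (Icc 0 1)) (hu : IntegrableOn u (Icc 0 1))
    (hx : ∀ s ∈ Icc (0 : ℝ) 1, ∀ t ∈ Icc (0 : ℝ) 1, x t - x s = ∫ r in s..t, ξ (x r) (u r))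
    (hx0 : x 0 = q t₀) (hx1 : x 1 = q t₁) :
    √(2 * E) * (t₁ - t₀) ≤ ∫ r in (0 : ℝ)..1, √(g (x r) (u r) (u r)) := by
  set T := t₁ - t₀ with hTdef
  have hT : 0 < T := sub_pos.2 ht
  set ρ : ℝ → ℝ := fun r => √(g (x r) (u r) (u r)) with hρ
  have hρ0 : ∀ r, 0 ≤ ρ r := fun r => Real.sqrt_nonneg _
  have hgx : ContinuousOn (fun r => g (x r)) (Icc 0 1) := hgc.comp hxc hxO
  have hξx : ContinuousOn (fun r => ξ (x r)) (Icc 0 1) := hξc.comp hxc hxO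
  have hρi : IntervalIntegrable ρ volume 0 1 := by
    rw [intervalIntegrable_iff_integrableOn_Icc_of_le zero_le_one]
    exact hgx.integrableOn_sqrt_apply₂ hu
  set ℓ := ∫ r in (0 : ℝ)..1, ρ r with hℓ
  have hℓ0 : 0 ≤ ℓ := intervalIntegral.integral_nonneg zero_le_one fun _ _ => hρ0 _
  have hξu : IntervalIntegrable (fun r => ξ (x r) (u r)) volume 0 1 := by
    rw [intervalIntegrable_iff_integrableOn_Icc_of_le zero_le_one]
    exact hξx.integrableOn_clm_apply hu
  -- The speed $\rho$ may vanish, so arc length is not a strictly increasing time; $\eta$ is added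
  -- to the speed and tends to $0$ at the end.
  suffices key : ∀ η > 0, 2 * E * T ^ 2 ≤ ℓ * (ℓ + η) by
    have h0 : 2 * E * T ^ 2 ≤ ℓ ^ 2 := by
      refine le_of_forall_pos_le_add fun ε hε => (key (ε / (ℓ + 1)) (by positivity)).trans ?_
      have : ℓ * (ε / (ℓ + 1)) ≤ ε := by
        rw [mul_div_assoc', div_le_iff₀ (by positivity)]; nlinarith
      nlinarith
    calc √(2 * E) * T = √(2 * E * T ^ 2) := by
          rw [Real.sqrt_mul' _ (sq_nonneg T), Real.sqrt_sq hT.le]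
      _ ≤ √(ℓ ^ 2) := Real.sqrt_le_sqrt h0
      _ = ℓ := Real.sqrt_sq hℓ0
  intro η hη
  have hℓη : 0 < ℓ + η := by positivity
  set κ := (ℓ + η) / T with hκ
  have hκ0 : 0 < κ := by positivity
  -- The density of the new time $\tau$: it is positive, has integral $T$, and $\rho\le\kappa a$
  -- says that the speed with respect to $\tau$ is at most $\kappa$.
  set a : ℝ → ℝ := fun r => κ⁻¹ * (ρ r + η) with ha
  have ha0 : ∀ r, 0 < a r := fun r => by have := hρ0 r; positivity
  have hai : IntervalIntegrable a volume 0 1 := (hρi.add intervalIntegrable_const).const_mul _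
  have ha1 : ∫ r in (0 : ℝ)..1, a r = T := by
    simp only [ha]
    rw [intervalIntegral.integral_const_mul, intervalIntegral.integral_add hρi
      intervalIntegrable_const, ← hℓ]
    simp [hκ]; field_simp
  have haρ : ∀ r, ρ r ≤ κ * a r := fun r => by
    simp only [ha]; rw [mul_inv_cancel_left₀ hκ0.ne']; linarith
  set τ : ℝ → ℝ := fun s => t₀ + ∫ r in (0 : ℝ)..s, a r with hτ
  have sub01 : ∀ {s t : ℝ}, s ∈ Icc (0 : ℝ) 1 → t ∈ Icc (0 : ℝ) 1 → uIcc s t ⊆ uIcc (0 : ℝ) 1 :=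
    fun {s t} hs ht => by rw [uIcc_of_le zero_le_one]; exact uIcc_subset_Icc hs ht
  have h0I : (0 : ℝ) ∈ Icc (0 : ℝ) 1 := left_mem_Icc.2 zero_le_one
  have h1I : (1 : ℝ) ∈ Icc (0 : ℝ) 1 := right_mem_Icc.2 zero_le_one
  have hτsub : ∀ s ∈ Icc (0 : ℝ) 1, ∀ t ∈ Icc (0 : ℝ) 1, τ t - τ s = ∫ r in s..t, a r := by
    intro s hs t ht
    rw [← intervalIntegral.integral_interval_sub_left (hai.mono_set (sub01 h0I ht))
      (hai.mono_set (sub01 h0I hs))]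
    simp [hτ]
  have hτc : ContinuousOn τ (Icc 0 1) := continuousOn_const.add (by
    simpa [uIcc_of_le (zero_le_one (α := ℝ))] using
      intervalIntegral.continuousOn_primitive_interval' hai left_mem_uIcc)
  have hτ0 : τ 0 = t₀ := by simp [hτ]
  have hτ1 : τ 1 = t₁ := by simp [hτ, ha1, hTdef]
  have hτm : ∀ s ∈ Icc (0 : ℝ) 1, ∀ t ∈ Icc (0 : ℝ) 1, s ≤ t → τ s ≤ τ t := fun s hs t ht hst => by
    rw [← sub_nonneg, hτsub s hs t ht]
    exact intervalIntegral.integral_nonneg hst fun _ _ => (ha0 _).le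
  have hτI : ∀ s ∈ Icc (0 : ℝ) 1, τ s ∈ Icc t₀ t₁ := fun s hs =>
    ⟨hτ0 ▸ hτm 0 h0I s hs hs.1, hτ1 ▸ hτm s hs 1 h1I hs.2⟩
  have hqτ : ContinuousOn (fun s => q (τ s)) (Icc 0 1) := fun s hs =>
    (hq _ (hτI s hs)).continuousAt.comp_continuousWithinAt (hτc s hs)
  have hpτ : ContinuousOn (fun s => p (τ s)) (Icc 0 1) := fun s hs =>
    (hp _ (hτI s hs)).continuousAt.comp_continuousWithinAt (hτc s hs)
  have hq'τ : ContinuousOn (fun s => q' (τ s)) (Icc 0 1) := hq'c.comp hτc hτI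
  have hp'τ : ContinuousOn (fun s => p' (τ s)) (Icc 0 1) := hp'c.comp hτc hτI
  set y : ℝ → B := fun s => x s - q (τ s) with hy
  have hyc : ContinuousOn y (Icc 0 1) := hxc.sub hqτ
  -- the pair `(x, τ)` as an absolutely continuous curve
  set Y : ℝ → B × ℝ := fun s => (x s, τ s) with hY
  set Y' : ℝ → B × ℝ := fun s => (ξ (x s) (u s), a s) with hY'
  have hY'i : IntervalIntegrable Y' volume 0 1 := by
    rw [intervalIntegrable_iff] at hξu hai ⊢
    exact hξu.prodMk hai
  have hYsub : ∀ s ∈ Icc (0 : ℝ) 1, ∀ t ∈ Icc (0 : ℝ) 1, Y t - Y s = ∫ r in s..t, Y' r := by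
    intro s hs t ht
    have h1 := hξu.mono_set (sub01 hs ht)
    have h2 := hai.mono_set (sub01 hs ht)
    have h3 := hY'i.mono_set (sub01 hs ht)
    refine Prod.ext ?_ ?_
    · refine (hx s hs t ht).trans ?_
      exact ContinuousLinearMap.intervalIntegral_comp_comm (ContinuousLinearMap.fst ℝ B ℝ) h3
    · refine (hτsub s hs t ht).trans ?_
      exact ContinuousLinearMap.intervalIntegral_comp_comm (ContinuousLinearMap.snd ℝ B ℝ) h3
  have hYc : ContinuousOn Y (Icc 0 1) := hxc.prodMk hτc
  set L₁ : ℝ → B × ℝ →L[ℝ] B := fun s =>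
    ContinuousLinearMap.fst ℝ B ℝ - (ContinuousLinearMap.snd ℝ B ℝ).smulRight (q' (τ s)) with hL₁
  have hL₁c : ContinuousOn L₁ (Icc 0 1) := continuousOn_const.sub
    ((ContinuousLinearMap.smulRightL ℝ (B × ℝ) B (ContinuousLinearMap.snd ℝ B ℝ)).continuous
      |>.comp_continuousOn hq'τ)
  have hL₁d : ∀ s ∈ Icc (0 : ℝ) 1, HasFDerivAt (fun z : B × ℝ => z.1 - q z.2) (L₁ s) (Y s) := by
    intro s hs
    have h1 : HasFDerivAt q ((1 : ℝ →L[ℝ] ℝ).smulRight (q' (τ s))) (Y s).2 :=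
      (hq _ (hτI s hs)).hasFDerivAt
    refine (hasFDerivAt_fst.sub (h1.comp (Y s) hasFDerivAt_snd)).congr_fderiv ?_
    ext <;> simp [hL₁]
  -- The differential of the approximate calibration $(x,\tau)\mapsto p(\tau)(x-q(\tau))$ along the
  -- curve.
  set L₂ : ℝ → B × ℝ →L[ℝ] ℝ := fun s =>
    (p (τ s)).comp (L₁ s) + (ContinuousLinearMap.snd ℝ B ℝ).smulRight (p' (τ s) (y s)) with hL₂
  have hL₂c : ContinuousOn L₂ (Icc 0 1) := (hpτ.clm_comp hL₁c).add
    ((ContinuousLinearMap.smulRightL ℝ (B × ℝ) ℝ (ContinuousLinearMap.snd ℝ B ℝ)).continuous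
      |>.comp_continuousOn (hp'τ.clm_apply hyc))
  have hL₂d : ∀ s ∈ Icc (0 : ℝ) 1,
      HasFDerivAt (fun z : B × ℝ => p z.2 (z.1 - q z.2)) (L₂ s) (Y s) := by
    intro s hs
    have h1 : HasFDerivAt p ((1 : ℝ →L[ℝ] ℝ).smulRight (p' (τ s))) (Y s).2 :=
      (hp _ (hτI s hs)).hasFDerivAt
    refine ((h1.comp (Y s) hasFDerivAt_snd).clm_apply (hL₁d s hs)).congr_fderiv ?_
    ext <;> simp [hL₂, hY, hy]
  -- the deviation from the extremal
  set N : ℝ → F := fun s => n (x s, p (τ s)) with hN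
  have hNc : ContinuousOn N (Icc 0 1) :=
    hnc.comp (hxc.prodMk hpτ) fun s hs => ⟨hxO s hs, mem_univ _⟩
  set W : ℝ → ℝ := fun s => ‖(a s)⁻¹ • u s - N s‖ with hW
  have haW : IntervalIntegrable (fun s => a s * W s) volume 0 1 := by
    have h1 : IntervalIntegrable (fun s => u s - a s • N s) volume 0 1 := by
      rw [intervalIntegrable_iff_integrableOn_Icc_of_le zero_le_one] at hai ⊢
      refine hu.sub ?_
      obtain ⟨K, hK⟩ := isCompact_Icc.exists_bound_of_continuousOn hNc
      refine (hai.norm.mul_const K).mono'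
        (hai.aestronglyMeasurable.smul hNc.aestronglyMeasurable_Icc) ?_
      filter_upwards [ae_restrict_mem measurableSet_Icc] with r hr
      rw [norm_smul]
      exact mul_le_mul_of_nonneg_left (hK r hr) (norm_nonneg _)
    refine h1.norm.congr ?_
    intro s _
    have : u s - a s • N s = a s • ((a s)⁻¹ • u s - N s) := by
      rw [smul_sub, smul_inv_smul₀ (ha0 s).ne']
    simp only [this, norm_smul, Real.norm_of_nonneg (ha0 s).le, hW]
  obtain ⟨s₀, hs₀, hmax⟩ := isCompact_Icc.exists_isMaxOn (nonempty_Icc.2 zero_le_one) hyc.norm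
  set m := ‖y s₀‖ with hm
  have hm0 : 0 ≤ m := norm_nonneg _
  have hym : ∀ s ∈ Icc (0 : ℝ) 1, ‖y s‖ ≤ m := fun s hs => hmax hs
  set J := ∫ s in (0 : ℝ)..1, a s * W s with hJ
  -- The derivative of $y$ is $a\,(\xi w+(\xi N-q'))$ with $w=a^{-1}u-N$: the first term is at most
  -- $CW$ and the second at most $C\|y\|\le Cm$. Working with the maximum $m$ replaces Gronwall's
  -- lemma, since $CT\le\frac12$ absorbs the last term.
  have hdev : m ≤ C * J + C * m * T := by
    have h1 : ∀ r ∈ Icc (0 : ℝ) 1, ‖L₁ r (Y' r)‖ ≤ C * (a r * W r) + a r * (C * m) := by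
      intro r hr
      have h2 : L₁ r (Y' r) = a r • (ξ (x r) ((a r)⁻¹ • u r - N r)
          + (ξ (x r) (N r) - q' (τ r))) := by
        simp only [hL₁, hY', map_sub, map_smul]
        simp [smul_sub, smul_inv_smul₀ (ha0 r).ne']
      rw [h2, norm_smul, Real.norm_of_nonneg (ha0 r).le]
      have h3 : ‖ξ (x r) ((a r)⁻¹ • u r - N r)‖ ≤ C * W r :=
        ((ξ (x r)).le_opNorm _).trans
          (mul_le_mul_of_nonneg_right (hξ _ (hxO r hr)) (norm_nonneg _))
      have h4 : ‖ξ (x r) (N r) - q' (τ r)‖ ≤ C * m :=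
        (hlip _ (hτI r hr) _ (hxO r hr)).trans (mul_le_mul_of_nonneg_left (hym r hr) hC.le)
      calc a r * _ ≤ a r * (C * W r + C * m) :=
            mul_le_mul_of_nonneg_left ((norm_add_le _ _).trans (add_le_add h3 h4)) (ha0 r).le
        _ = _ := by ring
    have i3 : IntervalIntegrable (fun r => C * (a r * W r) + a r * (C * m)) volume 0 1 :=
      (haW.const_mul _).add (hai.mul_const _)
    have hs₀' : Icc 0 s₀ ⊆ Icc (0 : ℝ) 1 := Icc_subset_Icc_right hs₀.2
    have h5 := (sub_eq_integral_of_hasFDerivAt hs₀.1 (hY'i.mono_set (sub01 h0I hs₀))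
      (fun s hs t ht => hYsub s (hs₀' hs) t (hs₀' ht)) (hYc.mono hs₀')
      (fun t ht => hL₁d t (hs₀' ht)) (hL₁c.mono hs₀')).2
    have h6 : y s₀ = ∫ r in (0 : ℝ)..s₀, L₁ r (Y' r) := by
      rw [← h5]; simp [hY, hy, hτ0, hx0]
    calc m = ‖∫ r in (0 : ℝ)..s₀, L₁ r (Y' r)‖ := by rw [hm, h6]
      _ ≤ ∫ r in (0 : ℝ)..s₀, (C * (a r * W r) + a r * (C * m)) :=
        intervalIntegral.norm_integral_le_of_norm_le hs₀.1
          (Eventually.of_forall fun r hr => h1 r (hs₀' (Ioc_subset_Icc_self hr)))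
          (i3.mono_set (sub01 h0I hs₀))
      _ ≤ ∫ r in (0 : ℝ)..1, (C * (a r * W r) + a r * (C * m)) := by
        refine intervalIntegral.integral_mono_interval le_rfl hs₀.1 hs₀.2
          (Eventually.of_forall fun r => ?_) i3
        have := (ha0 r).le
        have : 0 ≤ W r := norm_nonneg _
        show 0 ≤ C * (a r * W r) + a r * (C * m)
        positivity
      _ = C * J + C * m * T := by
        rw [intervalIntegral.integral_add (haW.const_mul _) (hai.mul_const _),
          intervalIntegral.integral_const_mul, intervalIntegral.integral_mul_const, ha1]
        ring
  have hmJ : m ≤ 2 * C * J := by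
    have : C * T * m ≤ 1 / 2 * m := mul_le_mul_of_nonneg_right hT₁ hm0
    linarith
  -- The calibrating function vanishes at both ends because the end points of $x$ and $q$ agree.
  have hzero : 0 = ∫ s in (0 : ℝ)..1, L₂ s (Y' s) := by
    rw [← (sub_eq_integral_of_hasFDerivAt zero_le_one hY'i hYsub hYc hL₂d hL₂c).2]
    simp [hY, hτ0, hτ1, hx0, hx1]
  set k := m / (2 * C * T) with hk
  set D := c * k ^ 2 / 2 + C₁ * m ^ 2 with hD
  -- Since $p\circ\xi=g(N,\cdot)$ and $p(q')=2E$, the left side is $g(N,u)-2aE+a\,p'(y)$. Completing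
  -- the square leaves $a\cdot\frac12g(N,N)$, the Hamiltonian at $(x,p)$, and its expansion at $q$
  -- cancels $a\,p'(y)$ up to $C_1\|y\|^2$.
  have hbound : ∀ s ∈ Icc (0 : ℝ) 1, L₂ s (Y' s) ≤
      κ / 2 * ρ s - a s * E - c * k * (a s * W s) + a s * D := by
    intro s hs
    have h1 : g (x s) (N s) (u s) ≤ κ / 2 * ρ s + a s / 2 * g (x s) (N s) (N s)
        - c * k * (a s * W s) + a s * (c * k ^ 2 / 2) :=
      apply_le_of_coercive (hsymm _ (hxO s hs)) (hco _ (hxO s hs)) hc.le (ha0 s) (u s)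
        (N s) (haρ s) k
    have h2 : L₂ s (Y' s) = g (x s) (N s) (u s) - a s * (2 * E) + a s * p' (τ s) (y s) := by
      rw [← hE _ (hτI s hs), ← hn _ (hxO s hs)]
      simp [hL₂, hL₁, hY']
    have h3 : 1 / 2 * g (x s) (N s) (N s) ≤ E - p' (τ s) (y s) + C₁ * ‖y s‖ ^ 2 :=
      htay _ (hτI s hs) _ (hxO s hs)
    have h4 : C₁ * ‖y s‖ ^ 2 ≤ C₁ * m ^ 2 := by gcongr; exact hym s hs
    have h5 := mul_le_mul_of_nonneg_left (h3.trans (add_le_add_right h4 _)) (ha0 s).le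
    have h6 : a s * D = a s * (c * k ^ 2 / 2) + a s * (C₁ * m ^ 2) := by rw [hD, mul_add]
    rw [h2, h6]
    linarith
  refine energy_mul_sq_le hT hc hC hm0 hmJ hT₂ (by rw [hκ]; field_simp : κ * T = ℓ + η) ?_
  have i1 : IntervalIntegrable (fun s => κ / 2 * ρ s - a s * E) volume 0 1 :=
    (hρi.const_mul _).sub (hai.mul_const _)
  have i2 : IntervalIntegrable (fun s => κ / 2 * ρ s - a s * E - c * k * (a s * W s))
    volume 0 1 := i1.sub (haW.const_mul _)
  calc 0 = ∫ s in (0 : ℝ)..1, L₂ s (Y' s) := hzero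
    _ ≤ ∫ s in (0 : ℝ)..1, (κ / 2 * ρ s - a s * E - c * k * (a s * W s) + a s * D) :=
      intervalIntegral.integral_mono_on zero_le_one
        (sub_eq_integral_of_hasFDerivAt zero_le_one hY'i hYsub hYc hL₂d hL₂c).1
        (i2.add (hai.mul_const _)) hbound
    _ = κ / 2 * ℓ - T * E - c * k * J + T * D := by
      rw [intervalIntegral.integral_add i2 (hai.mul_const _),
        intervalIntegral.integral_sub i1 (haW.const_mul _),
        intervalIntegral.integral_sub (hρi.const_mul _) (hai.mul_const _),
        intervalIntegral.integral_const_mul, intervalIntegral.integral_const_mul,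
        intervalIntegral.integral_mul_const, intervalIntegral.integral_mul_const, ha1]

/-! ### Coercivity and Riesz representation for strong metrics. -/

section Riesz

variable {V F : Type*} [AddCommGroup V] [Module ℝ V] [TopologicalSpace V]
  [NormedAddCommGroup F] [NormedSpace ℝ F]
  {g : V →L[ℝ] V →L[ℝ] ℝ}

/-- A form whose norm defines the topology is coercive. -/
theorem exists_coercive (e : V ≃L[ℝ] F)
    (hstrong : ∀ s : Set V, s ∈ 𝓝 (0 : V) ↔ ∃ ε : ℝ, 0 < ε ∧ {u : V | √(g u u) < ε} ⊆ s) :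
    ∃ c : ℝ, 0 < c ∧ ∀ v, c * ‖e v‖ ^ 2 ≤ g v v := by
  have hs : e ⁻¹' Metric.ball 0 1 ∈ 𝓝 (0 : V) :=
    e.continuous.continuousAt.preimage_mem_nhds (by simpa using Metric.ball_mem_nhds _ one_pos)
  obtain ⟨ε, hε, h⟩ := (hstrong _).1 hs
  refine ⟨ε ^ 2, by positivity, fun v => ?_⟩
  by_contra! hv
  have hpos : 0 < ‖e v‖ := by
    by_contra! h0
    have : e v = 0 := norm_le_zero_iff.1 h0
    have hv0 : v = 0 := by simpa using this
    simp [hv0] at hv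
  -- Were coercivity with $c=\varepsilon^2$ to fail at $v$, the normalized vector would lie in the
  -- $g$-ball of radius $\varepsilon$, hence in the open unit ball, although it has norm $1$.
  have h1 : √(g (‖e v‖⁻¹ • v) (‖e v‖⁻¹ • v)) < ε := by
    rw [Real.sqrt_lt' hε]
    simp only [map_smul, smul_eq_mul, _root_.smul_apply]
    rw [← mul_assoc, ← sq, inv_pow, inv_mul_lt_iff₀ (by positivity)]
    linarith
  have h2 := h h1
  simp [norm_smul, hpos.ne'] at h2

/-- The Riesz representation theorem for a form whose norm defines a complete topology. -/
theorem exists_eq_apply_of_strong [IsTopologicalAddGroup V] [ContinuousSMul ℝ V] [CompleteSpace F]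
    (e : V ≃L[ℝ] F) (hsymm : ∀ v w, g v w = g w v) (hpos : ∀ v, v ≠ 0 → 0 < g v v)
    (hstrong : ∀ s : Set V, s ∈ 𝓝 (0 : V) ↔ ∃ ε : ℝ, 0 < ε ∧ {u : V | √(g u u) < ε} ⊆ s)
    (φ : V →L[ℝ] ℝ) : ∃ u, ∀ v, φ v = g u v := by
  obtain ⟨c, hc, hco⟩ := exists_coercive e hstrong
  let core : InnerProductSpace.Core ℝ V :=
    { inner := fun v w => g v w
      conj_inner_symm := fun v w => hsymm w v
      re_inner_nonneg := fun v => by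
        rcases eq_or_ne v 0 with rfl | hv
        · simp
        · exact (hpos v hv).le
      add_left := fun v w x => by simp
      smul_left := fun v w r => by simp
      definite := fun v h => by
        by_contra h0
        exact (hpos v h0).ne' h }
  have hcont : ContinuousAt (fun v : V => g v v) 0 := by
    rw [Metric.continuousAt_iff']
    intro η hη
    refine (hstrong _).2 ⟨√η, Real.sqrt_pos.2 hη, fun v hv => ?_⟩
    have h0 : 0 ≤ g v v := by
      rcases eq_or_ne v 0 with rfl | hv
      · simp
      · exact (hpos v hv).le
    simpa [abs_of_nonneg h0] using (Real.sqrt_lt_sqrt_iff h0).1 hv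
  -- Together with `hcont`, this makes the norm of $g$ induce the given topology, so that $\varphi$
  -- stays continuous and completeness passes from `F` to `V`.
  have hbdd : Bornology.IsVonNBounded ℝ {v : V | g v v < 1} := by
    have h1 : Bornology.IsVonNBounded ℝ (Metric.closedBall (0 : F) √(c⁻¹)) :=
      NormedSpace.isVonNBounded_closedBall ℝ F _
    refine Bornology.IsVonNBounded.subset (fun v hv => ?_) (h1.image (e.symm : F →L[ℝ] V))
    refine ⟨e v, ?_, by simp⟩
    rw [mem_closedBall_zero_iff]
    refine Real.le_sqrt_of_sq_le ?_
    rw [← one_div, le_div_iff₀' hc]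
    exact (hco v).trans (le_of_lt hv)
  let : NormedAddCommGroup V := core.toNormedAddCommGroupOfTopology hcont hbdd
  let : InnerProductSpace ℝ V := .ofCoreOfTopology core hcont hbdd
  have : CompleteSpace V :=
    (completeSpace_congr (e := e.toEquiv) e.isUniformEmbedding).2 inferInstance
  exact ⟨(InnerProductSpace.toDual ℝ V).symm φ, fun v =>
    (InnerProductSpace.toDual_symm_apply (x := v) (y := φ)).symm⟩

end Riesz

/-! ### Strong structures in coordinates: control, Hamiltonian and uniform bounds. -/

section LocalModel

variable {B F : Type*} [NormedAddCommGroup B] [NormedSpace ℝ B]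
  [NormedAddCommGroup F] [NormedSpace ℝ F]

/-- A strong sub-Riemannian structure on an open set `U` of the model space, in a trivialization. -/
structure IsLocalModel (ξ : B → F →L[ℝ] B) (g : B → F →L[ℝ] F →L[ℝ] ℝ) (U : Set B) : Prop where
  isOpen : IsOpen U
  contDiffOn_anchor : ContDiffOn ℝ ∞ ξ U
  contDiffOn_metric : ContDiffOn ℝ ∞ g U
  symm : ∀ x ∈ U, ∀ v w, g x v w = g x w v
  coercive : ∀ x ∈ U, ∃ c : ℝ, 0 < c ∧ ∀ v, c * ‖v‖ ^ 2 ≤ g x v v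
  surjective : ∀ x ∈ U, Function.Surjective (g x)

/-- The normal control in coordinates. -/
def localControl (ξ : B → F →L[ℝ] B) (g : B → F →L[ℝ] F →L[ℝ] ℝ) (z : B × (B →L[ℝ] ℝ)) : F :=
  (g z.1).inverse (z.2 ∘L ξ z.1)

/-- The normal Hamiltonian in coordinates. -/
def localHamiltonian (ξ : B → F →L[ℝ] B) (g : B → F →L[ℝ] F →L[ℝ] ℝ) (z : B × (B →L[ℝ] ℝ)) : ℝ :=
  1 / 2 * g z.1 (localControl ξ g z) (localControl ξ g z)

/-- The Hamiltonian vector field in coordinates. -/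
def localField (ξ : B → F →L[ℝ] B) (g : B → F →L[ℝ] F →L[ℝ] ℝ) (z : B × (B →L[ℝ] ℝ)) :
    B × (B →L[ℝ] ℝ) :=
  (ξ z.1 (localControl ξ g z),
    -((fderiv ℝ (localHamiltonian ξ g) z) ∘L ContinuousLinearMap.inl ℝ B (B →L[ℝ] ℝ)))

namespace IsLocalModel

variable {ξ : B → F →L[ℝ] B} {g : B → F →L[ℝ] F →L[ℝ] ℝ} {U : Set B} (h : IsLocalModel ξ g U)
include h

theorem injective {x : B} (hx : x ∈ U) : Function.Injective (g x) := by
  obtain ⟨c, hc, hco⟩ := h.coercive x hx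
  refine (injective_iff_map_eq_zero _).2 fun v hv => ?_
  have h1 := hco v
  rw [hv] at h1
  have : ‖v‖ ^ 2 ≤ 0 := by
    by_contra! h2
    have := mul_pos hc h2
    simp at h1
    linarith
  simpa using pow_eq_zero_iff (two_ne_zero) |>.1 (le_antisymm this (sq_nonneg _))

variable [CompleteSpace F]

/-- Coercivity gives injectivity, and completeness turns the continuous bijection onto the dual into
an isomorphism by the open mapping theorem. -/
theorem isInvertible {x : B} (hx : x ∈ U) : (g x).IsInvertible :=
  ⟨ContinuousLinearEquiv.ofBijective (g x) (LinearMap.ker_eq_bot.2 (h.injective hx))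
    (LinearMap.range_eq_top.2 (h.surjective x hx)), by ext; rfl⟩

theorem apply_localControl {z : B × (B →L[ℝ] ℝ)} (hz : z.1 ∈ U) (v : F) :
    g z.1 (localControl ξ g z) v = z.2 (ξ z.1 v) := by
  have := ((h.isInvertible hz).inverse_apply_eq (y := z.2 ∘L ξ z.1)).1 rfl
  rw [localControl, ← this]; rfl

theorem eq_localControl {z : B × (B →L[ℝ] ℝ)} (hz : z.1 ∈ U) {u : F}
    (hu : ∀ v, z.2 (ξ z.1 v) = g z.1 u v) : u = localControl ξ g z :=
  h.injective hz (by ext v; rw [h.apply_localControl hz, hu])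

/-- Operator inversion is smooth at an isomorphism, and the control depends bilinearly on the
inverse of $g_x$ and on $p\circ\xi_x$. -/
theorem contDiffAt_localControl {z : B × (B →L[ℝ] ℝ)} (hz : z.1 ∈ U) :
    ContDiffAt ℝ ∞ (localControl ξ g) z := by
  have hU := h.isOpen.mem_nhds hz
  have h1 : ContDiffAt ℝ ∞ (fun z : B × (B →L[ℝ] ℝ) => g z.1) z :=
    (h.contDiffOn_metric.contDiffAt hU).comp z contDiffAt_fst
  have h2 : ContDiffAt ℝ ∞ (fun z : B × (B →L[ℝ] ℝ) => ξ z.1) z :=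
    (h.contDiffOn_anchor.contDiffAt hU).comp z contDiffAt_fst
  obtain ⟨e, he⟩ := h.isInvertible hz
  have h3 : ContDiffAt ℝ ∞ (ContinuousLinearMap.inverse : (F →L[ℝ] F →L[ℝ] ℝ) → _) (g z.1) :=
    he ▸ contDiffAt_map_inverse e
  exact (h3.comp z h1).clm_apply (contDiffAt_snd.clm_comp h2)

theorem contDiffAt_localHamiltonian {z : B × (B →L[ℝ] ℝ)} (hz : z.1 ∈ U) :
    ContDiffAt ℝ ∞ (localHamiltonian ξ g) z := by
  have hU := h.isOpen.mem_nhds hz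
  have h1 : ContDiffAt ℝ ∞ (fun z : B × (B →L[ℝ] ℝ) => g z.1) z :=
    (h.contDiffOn_metric.contDiffAt hU).comp z contDiffAt_fst
  have h2 := h.contDiffAt_localControl hz
  exact contDiffAt_const.mul ((h1.clm_apply h2).clm_apply h2)

theorem contDiffAt_velocity {z : B × (B →L[ℝ] ℝ)} (hz : z.1 ∈ U) :
    ContDiffAt ℝ ∞ (fun z : B × (B →L[ℝ] ℝ) => ξ z.1 (localControl ξ g z)) z :=
  ((h.contDiffOn_anchor.contDiffAt (h.isOpen.mem_nhds hz)).comp z contDiffAt_fst).clm_apply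
    (h.contDiffAt_localControl hz)

theorem contDiffAt_localField {z : B × (B →L[ℝ] ℝ)} (hz : z.1 ∈ U) :
    ContDiffAt ℝ ∞ (localField ξ g) z :=
  (h.contDiffAt_velocity hz).prodMk
    ((((h.contDiffAt_localHamiltonian hz).fderiv_right (m := ∞) (by simp)).clm_comp
      contDiffAt_const).neg)

theorem two_mul_localHamiltonian {z : B × (B →L[ℝ] ℝ)} (hz : z.1 ∈ U) :
    2 * localHamiltonian ξ g z = z.2 (ξ z.1 (localControl ξ g z)) := by
  rw [localHamiltonian, h.apply_localControl hz]; ring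

theorem fderiv_localHamiltonian_inr {z : B × (B →L[ℝ] ℝ)} (hz : z.1 ∈ U) (δ : B →L[ℝ] ℝ) :
    fderiv ℝ (localHamiltonian ξ g) z (0, δ) = δ (ξ z.1 (localControl ξ g z)) := by
  have h1 : HasDerivAt (fun s : ℝ => localHamiltonian ξ g (z + s • (0, δ)))
      (fderiv ℝ (localHamiltonian ξ g) z (0, δ)) 0 := by
    have h2 : HasFDerivAt (localHamiltonian ξ g) (fderiv ℝ (localHamiltonian ξ g) z)
        (z + (0 : ℝ) • ((0, δ) : B × (B →L[ℝ] ℝ))) := by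
      simpa using ((h.contDiffAt_localHamiltonian hz).differentiableAt (by simp)).hasFDerivAt
    have h3 : HasDerivAt (fun s : ℝ => z + s • ((0, δ) : B × (B →L[ℝ] ℝ))) ((0, δ)) 0 := by
      simpa using ((hasDerivAt_id (0 : ℝ)).smul_const ((0, δ) : B × (B →L[ℝ] ℝ))).const_add z
    exact h2.comp_hasDerivAt 0 h3
  -- The Hamiltonian is quadratic in $p$: on this line it is a polynomial in $s$, and its linear
  -- coefficient is the derivative sought.
  have h4 : (fun s : ℝ => localHamiltonian ξ g (z + s • (0, δ))) = fun s =>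
      localHamiltonian ξ g z + s * δ (ξ z.1 (localControl ξ g z))
        + s ^ 2 * localHamiltonian ξ g (z.1, δ) := by
    funext s
    have e : localControl ξ g (z + s • (0, δ)) =
        localControl ξ g z + s • localControl ξ g (z.1, δ) := by
      simp [localControl, ContinuousLinearMap.add_comp, ContinuousLinearMap.smul_comp]
    have e1 : (z + s • ((0, δ) : B × (B →L[ℝ] ℝ))).1 = z.1 := by simp
    have e2 := h.apply_localControl (z := (z.1, δ)) hz (localControl ξ g z)
    have e3 := h.symm _ hz (localControl ξ g z) (localControl ξ g (z.1, δ))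
    simp only [localHamiltonian, e, e1, map_add, map_smul, _root_.add_apply,
      _root_.smul_apply, smul_eq_mul, e3, e2]
    ring
  rw [h4] at h1
  have h5 : HasDerivAt (fun s : ℝ => localHamiltonian ξ g z
      + s * δ (ξ z.1 (localControl ξ g z)) + s ^ 2 * localHamiltonian ξ g (z.1, δ))
      (δ (ξ z.1 (localControl ξ g z))) 0 := by
    refine HasDerivAt.congr_deriv ((((hasDerivAt_id (0 : ℝ)).mul_const
      (δ (ξ z.1 (localControl ξ g z)))).const_add
      (localHamiltonian ξ g z)).add
      (((hasDerivAt_id (0 : ℝ)).pow 2).mul_const (localHamiltonian ξ g (z.1, δ)))) (by simp)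
  exact h1.unique h5

/-- The vector field is the Hamiltonian vector field of the Hamiltonian. -/
theorem fderiv_localHamiltonian {z : B × (B →L[ℝ] ℝ)} (hz : z.1 ∈ U) (w : B × (B →L[ℝ] ℝ)) :
    fderiv ℝ (localHamiltonian ξ g) z w = w.2 (localField ξ g z).1 - (localField ξ g z).2 w.1 := by
  have : w = (w.1, 0) + (0, w.2) := by simp
  conv_lhs => rw [this, map_add, h.fderiv_localHamiltonian_inr hz]
  simp [localField, add_comm]


/-- Provides constants, uniform on one ball, for the hypotheses of `sqrt_energy_mul_le_integral`.
Closed balls are not compact in infinite dimension, so all of them come from continuity and local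
Lipschitz bounds at the single point $z_0$. -/
theorem exists_bounds {z₀ : B × (B →L[ℝ] ℝ)} (hz₀ : z₀.1 ∈ U) :
    ∃ r > 0, ∃ c > 0, ∃ C > 0, ∃ C₁ ≥ 0, Metric.ball z₀.1 r ⊆ U ∧
      (∀ x ∈ Metric.ball z₀.1 r, (∀ v, c * ‖v‖ ^ 2 ≤ g x v v) ∧ ‖ξ x‖ ≤ C) ∧
      ∀ x ∈ Metric.ball z₀.1 r, ∀ y ∈ Metric.ball z₀.1 r, ∀ p ∈ Metric.ball z₀.2 r,
        ‖ξ x (localControl ξ g (x, p)) - ξ y (localControl ξ g (y, p))‖ ≤ C * ‖x - y‖ ∧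
        localHamiltonian ξ g (x, p) ≤ localHamiltonian ξ g (y, p)
          - (localField ξ g (y, p)).2 (x - y) + C₁ * ‖x - y‖ ^ 2 := by
  have hU := h.isOpen.mem_nhds hz₀
  obtain ⟨c, hc, hco⟩ := h.coercive _ hz₀
  have e1 : ∀ᶠ x in 𝓝 z₀.1, ‖g x - g z₀.1‖ < c / 2 := by
    have := (h.contDiffOn_metric.contDiffAt hU).continuousAt.eventually
      (Metric.ball_mem_nhds _ (half_pos hc))
    filter_upwards [this] with x hx
    rwa [dist_eq_norm] at hx
  have e2 : ∀ᶠ x in 𝓝 z₀.1, ‖ξ x‖ < ‖ξ z₀.1‖ + 1 :=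
    (h.contDiffOn_anchor.contDiffAt hU).continuousAt.norm.eventually (gt_mem_nhds (by simp))
  obtain ⟨K₁, s₁, hs₁, hK₁⟩ :=
    ((h.contDiffAt_velocity hz₀).of_le (m := 1) (by simp)).exists_lipschitzOnWith
  obtain ⟨K₂, s₂, hs₂, hK₂⟩ := ((h.contDiffAt_localHamiltonian hz₀).fderiv_right (m := 1)
    (by norm_num; exact WithTop.coe_le_coe.2 le_top)).exists_lipschitzOnWith
  have e3 : ∀ᶠ z : B × (B →L[ℝ] ℝ) in 𝓝 z₀, (z.1 ∈ U ∧ ‖g z.1 - g z₀.1‖ < c / 2 ∧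
      ‖ξ z.1‖ < ‖ξ z₀.1‖ + 1) ∧ z ∈ s₁ ∧ z ∈ s₂ :=
    (continuousAt_fst.eventually (Filter.Eventually.and hU (e1.and e2))).and
      (Filter.Eventually.and hs₁ hs₂)
  obtain ⟨r, hr, hball⟩ := Metric.eventually_nhds_iff_ball.1 e3
  have hmem : ∀ {x p}, x ∈ Metric.ball z₀.1 r → p ∈ Metric.ball z₀.2 r →
      (x, p) ∈ Metric.ball z₀ r := fun hx hp => by
    rw [← ball_prod_same]; exact ⟨hx, hp⟩
  have hz₀2 : z₀.2 ∈ Metric.ball z₀.2 r := Metric.mem_ball_self hr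
  -- Half of the coercivity is spent on the variation of $g$; `C` bounds both the anchor and the
  -- Lipschitz constant of the velocity; the quadratic error uses the Lipschitz constant `K₂` of
  -- $dh$.
  refine ⟨r, hr, c / 2, by positivity, max (‖ξ z₀.1‖ + 1) K₁, by positivity, K₂, K₂.2,
    fun x hx => (hball _ (hmem hx hz₀2)).1.1, fun x hx => ⟨fun v => ?_, ?_⟩, ?_⟩
  · have h1 := (hball _ (hmem hx hz₀2)).1.2.1
    have h2 : |(g x - g z₀.1) v v| ≤ c / 2 * ‖v‖ ^ 2 := by
      calc _ ≤ ‖g x - g z₀.1‖ * ‖v‖ * ‖v‖ := (g x - g z₀.1).le_opNorm₂ v v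
        _ ≤ c / 2 * ‖v‖ ^ 2 := by rw [mul_assoc, ← sq]; gcongr
    have h3 : (g x - g z₀.1) v v = g x v v - g z₀.1 v v := rfl
    rw [h3] at h2
    linarith [hco v, (abs_le.1 h2).1]
  · exact (hball _ (hmem hx hz₀2)).1.2.2.le.trans (le_max_left _ _)
  · intro x hx y hy p hp
    have hX := hball _ (hmem hx hp)
    have hY := hball _ (hmem hy hp)
    have hn : ‖((x, p) : B × (B →L[ℝ] ℝ)) - (y, p)‖ = ‖x - y‖ := by simp [Prod.norm_def]
    constructor
    · refine (hK₁.norm_sub_le hX.2.1 hY.2.1).trans ?_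
      rw [hn]
      exact mul_le_mul_of_nonneg_right (le_max_right _ _) (norm_nonneg _)
    · have hseg : segment ℝ ((y, p) : B × (B →L[ℝ] ℝ)) (x, p) ⊆ Metric.ball z₀ r :=
        (convex_ball z₀ r).segment_subset (hmem hy hp) (hmem hx hp)
      have h1 := (convex_segment (𝕜 := ℝ) ((y, p) : B × (B →L[ℝ] ℝ))
          (x, p)).norm_image_sub_le_of_norm_hasFDerivWithin_le'
        (f := localHamiltonian ξ g) (f' := fderiv ℝ (localHamiltonian ξ g))
        (φ := fderiv ℝ (localHamiltonian ξ g) (y, p)) (C := K₂ * ‖x - y‖)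
        (fun w hw => ((h.contDiffAt_localHamiltonian (hball w (hseg hw)).1.1).differentiableAt
          (by simp)).hasFDerivAt.hasFDerivWithinAt)
        (fun w hw => (hK₂.norm_sub_le (hball w (hseg hw)).2.2 hY.2.2).trans
          (mul_le_mul_of_nonneg_left ((norm_sub_le_of_mem_segment hw).trans hn.le) K₂.2))
        (left_mem_segment _ _ _) (right_mem_segment _ _ _)
      rw [hn, h.fderiv_localHamiltonian hY.1.1] at h1
      have h2 := (abs_le.1 h1).2
      simp only [Prod.mk_sub_mk, sub_self, _root_.zero_apply] at h2
      linarith [sq ‖x - y‖, mul_assoc (K₂ : ℝ) ‖x - y‖ ‖x - y‖]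

/-- Conservation of energy: $dh$ on its own Hamiltonian field is $\omega(X,X)=0$. -/
theorem localHamiltonian_eq_of_hasDerivAt {γ : ℝ → B × (B →L[ℝ] ℝ)} {t₀ t₁ : ℝ}
    (hU : ∀ t ∈ Icc t₀ t₁, (γ t).1 ∈ U)
    (hγ : ∀ t ∈ Icc t₀ t₁, HasDerivAt γ (localField ξ g (γ t)) t) {t : ℝ} (ht : t ∈ Icc t₀ t₁) :
    localHamiltonian ξ g (γ t) = localHamiltonian ξ g (γ t₀) := by
  have hd : ∀ t ∈ Icc t₀ t₁, HasDerivAt (fun t => localHamiltonian ξ g (γ t)) 0 t := by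
    intro t ht
    have h1 := ((h.contDiffAt_localHamiltonian (hU t ht)).differentiableAt
      (by simp)).hasFDerivAt.comp_hasDerivAt t (hγ t ht)
    rwa [h.fderiv_localHamiltonian (hU t ht), sub_self] at h1
  exact constant_of_has_deriv_right_zero
    (fun t ht => (hd t ht).continuousAt.continuousWithinAt)
    (fun t ht => (hd t (Ico_subset_Icc_self ht)).hasDerivWithinAt) t ht

/-- Short normal extremals are at least as short as the curves of the same chart ball. -/
theorem exists_sqrt_mul_le_integral [CompleteSpace B] {z₀ : B × (B →L[ℝ] ℝ)} (hz₀ : z₀.1 ∈ U) :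
    ∃ r > 0, ∃ δ > 0, ∃ K > 0, Metric.ball z₀.1 r ⊆ U ∧
      (∀ x ∈ Metric.ball z₀.1 r, ∀ v, ‖ξ x v‖ ≤ K * √(g x v v)) ∧
      ∀ (t₀ t₁ : ℝ), t₀ < t₁ → t₁ - t₀ ≤ δ → ∀ γ : ℝ → B × (B →L[ℝ] ℝ),
        (∀ t ∈ Icc t₀ t₁, γ t ∈ Metric.ball z₀ r) →
        (∀ t ∈ Icc t₀ t₁, HasDerivAt γ (localField ξ g (γ t)) t) →
        ∀ (x : ℝ → B) (u : ℝ → F), (∀ s ∈ Icc (0 : ℝ) 1, x s ∈ Metric.ball z₀.1 r) →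
          ContinuousOn x (Icc 0 1) → IntegrableOn u (Icc 0 1) →
          (∀ s ∈ Icc (0 : ℝ) 1, ∀ t ∈ Icc (0 : ℝ) 1,
            x t - x s = ∫ r in s..t, ξ (x r) (u r)) →
          x 0 = (γ t₀).1 → x 1 = (γ t₁).1 →
          √(2 * localHamiltonian ξ g (γ t₀)) * (t₁ - t₀) ≤
            ∫ r in (0 : ℝ)..1, √(g (x r) (u r) (u r)) := by
  obtain ⟨r, hr, c, hc, C, hC, C₁, hC₁, hU, hb, hbb⟩ := h.exists_bounds hz₀
  -- The two entries of the minimum give $CT\le\frac12$ and $8C^2C_1T^2\le c$; $C_1+1$ guards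
  -- against $C_1=0$. The ratio $C/\sqrt c$ compares chart speed with metric speed.
  refine ⟨r, hr, min (1 / (2 * C)) √(c / (8 * C ^ 2 * (C₁ + 1))),
    lt_min (by positivity) (Real.sqrt_pos.2 (by positivity)), C / √c, by positivity, hU, ?_, ?_⟩
  · intro x hx v
    have h1 : √c * ‖v‖ ≤ √(g x v v) := by
      rw [← Real.sqrt_sq (norm_nonneg v), ← Real.sqrt_mul hc.le]
      exact Real.sqrt_le_sqrt ((hb x hx).1 v)
    calc ‖ξ x v‖ ≤ C * ‖v‖ := ((ξ x).le_opNorm v).trans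
          (mul_le_mul_of_nonneg_right (hb x hx).2 (norm_nonneg _))
      _ = C / √c * (√c * ‖v‖) := by field_simp
      _ ≤ C / √c * √(g x v v) := by gcongr
  · intro t₀ t₁ ht hδ γ hγ hγ' x u hx hxc hu hxu hx0 hx1
    have hT : 0 < t₁ - t₀ := sub_pos.2 ht
    have hγ1 : ∀ t ∈ Icc t₀ t₁, (γ t).1 ∈ Metric.ball z₀.1 r ∧ (γ t).2 ∈ Metric.ball z₀.2 r := by
      intro t ht
      have := hγ t ht
      rwa [← Prod.mk.eta (p := z₀), ← ball_prod_same] at this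
    have hγU : ∀ t ∈ Icc t₀ t₁, (γ t).1 ∈ U := fun t ht => hU (hγ1 t ht).1
    have hγc : ContinuousOn γ (Icc t₀ t₁) := fun t ht =>
      (hγ' t ht).continuousAt.continuousWithinAt
    have hfc : ContinuousOn (fun t => localField ξ g (γ t)) (Icc t₀ t₁) := fun t ht =>
      (h.contDiffAt_localField (hγU t ht)).continuousAt.comp_continuousWithinAt (hγc t ht)
    have hO := h.contDiffOn_anchor.continuousOn.mono hU
    refine sqrt_energy_mul_le_integral (ξ := ξ) (g := g) (n := localControl ξ g)
      (O := Metric.ball z₀.1 r) (c := c) (C := C) (C₁ := C₁)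
      (E := localHamiltonian ξ g (γ t₀)) (t₀ := t₀) (t₁ := t₁) (q := fun t => (γ t).1)
      (p := fun t => (γ t).2) (q' := fun t => (localField ξ g (γ t)).1)
      (p' := fun t => (localField ξ g (γ t)).2) hO
      (h.contDiffOn_metric.continuousOn.mono hU) ?_ (fun x hx => h.symm x (hU hx))
      (fun x hx p v => (h.apply_localControl (z := (x, p)) (hU hx) v).symm) hc hC hC₁
      (fun x hx => (hb x hx).1) (fun x hx => (hb x hx).2) ht
      (fun t ht => (hγ' t ht).fst) (fun t ht => (hγ' t ht).snd)
      (continuous_fst.comp_continuousOn hfc) (continuous_snd.comp_continuousOn hfc) ?_ ?_ ?_ ?_ ?_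
      hx hxc hu hxu hx0 hx1
    · intro z hz
      exact (h.contDiffAt_localControl (hU hz.1)).continuousAt.continuousWithinAt
    · intro t ht x hx
      exact (hbb x hx _ (hγ1 t ht).1 _ (hγ1 t ht).2).1
    · intro t ht
      rw [← h.localHamiltonian_eq_of_hasDerivAt hγU hγ' ht,
        h.two_mul_localHamiltonian (hγU t ht)]
      rfl
    · intro t ht x hx
      rw [← h.localHamiltonian_eq_of_hasDerivAt hγU hγ' ht]
      exact (hbb x hx _ (hγ1 t ht).1 _ (hγ1 t ht).2).2
    · calc C * (t₁ - t₀) ≤ C * (1 / (2 * C)) := by gcongr; exact hδ.trans (min_le_left _ _)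
        _ = 1 / 2 := by field_simp
    · have h1 : (t₁ - t₀) ^ 2 ≤ c / (8 * C ^ 2 * (C₁ + 1)) :=
        (Real.le_sqrt hT.le (by positivity)).1 (hδ.trans (min_le_right _ _))
      have h2 := (le_div_iff₀ (by positivity)).1 h1
      nlinarith [mul_pos (sq_pos_of_pos hT) (sq_pos_of_pos hC)]

end IsLocalModel
end LocalModel

/-! ### Canonical coordinates of $T^*M$ and invariance of the symplectic form. -/

/-- The cotangent lift of a coordinate change preserves the canonical symplectic form. -/
theorem cotangentLift_symplectic {B : Type*} [NormedAddCommGroup B] [NormedSpace ℝ B]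
    {φ χ : B → B} {φ' : B →L[ℝ] B} {z : B × (B →L[ℝ] ℝ)} (hφ : HasFDerivAt φ φ' z.1)
    (hχ : ContDiffAt ℝ 2 χ (φ z.1)) (hφχ : ∀ v, fderiv ℝ χ (φ z.1) (φ' v) = v)
    {D : B × (B →L[ℝ] ℝ) →L[ℝ] B × (B →L[ℝ] ℝ)}
    (hD : HasFDerivAt (fun w : B × (B →L[ℝ] ℝ) => (φ w.1, w.2 ∘L fderiv ℝ χ (φ w.1))) D z)
    (X Y : B × (B →L[ℝ] ℝ)) :
    (D Y).2 (D X).1 - (D X).2 (D Y).1 = Y.2 X.1 - X.2 Y.1 := by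
  have h1 : HasFDerivAt (fun w : B × (B →L[ℝ] ℝ) => φ w.1)
      (φ' ∘L ContinuousLinearMap.fst ℝ B (B →L[ℝ] ℝ)) z := hφ.comp z hasFDerivAt_fst
  have h2 : HasFDerivAt (fderiv ℝ χ) (fderiv ℝ (fderiv ℝ χ) (φ z.1)) (φ z.1) :=
    ((hχ.fderiv_right (m := 1) (by norm_num)).differentiableAt (by simp)).hasFDerivAt
  have h3 := h1.prodMk (hasFDerivAt_snd.clm_comp (h2.comp z h1))
  have hDX : ∀ X : B × (B →L[ℝ] ℝ), D X = (φ' X.1, X.2 ∘L fderiv ℝ χ (φ z.1)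
      + z.2 ∘L fderiv ℝ (fderiv ℝ χ) (φ z.1) (φ' X.1)) := by
    intro X
    rw [hD.unique h3]
    ext <;> simp [add_comm]
  -- Differentiating the fibre component produces the term $p\circ D^2\chi$; being symmetric, it
  -- cancels in the antisymmetrization.
  have hs := hχ.isSymmSndFDerivAt (by simp) (φ' X.1) (φ' Y.1)
  simp only [hDX, _root_.add_apply, ContinuousLinearMap.comp_apply, hφχ, hs]
  ring

section Cotangent

variable {B : Type*} [NormedAddCommGroup B] [NormedSpace ℝ B]
  {M : Type*} [TopologicalSpace M] [ChartedSpace B M] [IsManifold 𝓘(ℝ, B) ∞ M]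

/-- The canonical coordinates of `T*M` given by the preferred chart at `x₀`. -/
def cotangentCoord (x₀ : M) (z : CotangentBundle B M) : B × (B →L[ℝ] ℝ) :=
  (chartAt B x₀ z.proj,
    (z.snd : TangentSpace 𝓘(ℝ, B) z.proj →L[ℝ] ℝ) ∘L
      (trivializationAt B (TangentSpace 𝓘(ℝ, B)) x₀).symmL ℝ z.proj)

/-- Makes the bundle chart explicit; it depends on `z₀` only through its base point. -/
theorem extChartAt_cotangent_apply (z₀ z : CotangentBundle B M) :
    extChartAt (cotangentModel B) z₀ z = cotangentCoord z₀.proj z := by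
  refine Prod.ext rfl ?_
  change ContinuousLinearMap.inCoordinates B (TangentSpace 𝓘(ℝ, B)) ℝ (Bundle.Trivial M ℝ)
    z₀.proj z.proj z₀.proj z.proj z.snd = _
  ext v
  simp [ContinuousLinearMap.inCoordinates, cotangentCoord]

theorem extChartAt_cotangent_source (z₀ : CotangentBundle B M) :
    (extChartAt (cotangentModel B) z₀).source =
      {z | z.proj ∈ (chartAt B z₀.proj).source} := by
  ext z
  rw [extChartAt_source]
  simp [FiberBundle.chartedSpace_chartAt]
  exact fun h => h

/-- Covectors move by the transpose of the inverse: the tangent coordinate change runs from `x₀` to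
`x`, opposite to the change of covector coordinates. -/
theorem cotangentCoord_snd_eq {x x₀ : M} {z : CotangentBundle B M}
    (hx : z.proj ∈ (chartAt B x).source) (hx₀ : z.proj ∈ (chartAt B x₀).source) :
    (cotangentCoord x₀ z).2 =
      (cotangentCoord x z).2 ∘L tangentCoordChange 𝓘(ℝ, B) x₀ x z.proj := by
  ext v
  simp only [cotangentCoord, ContinuousLinearMap.comp_apply]
  congr 1
  have h1 := congrArg (fun L : B →L[ℝ] B => L v)
    (TangentBundle.symmL_trivializationAt_eq_core (I := 𝓘(ℝ, B)) hx₀)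
  have h2 := congrArg (fun L : B →L[ℝ] B => L (tangentCoordChange 𝓘(ℝ, B) x₀ x z.proj v))
    (TangentBundle.symmL_trivializationAt_eq_core (I := 𝓘(ℝ, B)) hx)
  refine h1.trans (Eq.trans ?_ h2.symm)
  exact (tangentCoordChange_comp (I := 𝓘(ℝ, B)) (by
    simp only [extChartAt_source]
    exact ⟨⟨hx₀, hx⟩, mem_chart_source B z.proj⟩)).symm

/-- The change of canonical coordinates is the cotangent lift of the change of charts. -/
theorem cotangentCoord_eventuallyEq {z z₀ : CotangentBundle B M}
    (hz : z.proj ∈ (chartAt B z₀.proj).source) :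
    (extChartAt (cotangentModel B) z₀ ∘ (extChartAt (cotangentModel B) z).symm) =ᶠ[
      𝓝 (extChartAt (cotangentModel B) z z)]
    fun w => ((chartAt B z₀.proj ∘ (chartAt B z.proj).symm) w.1,
      w.2 ∘L fderiv ℝ (chartAt B z.proj ∘ (chartAt B z₀.proj).symm)
        ((chartAt B z₀.proj ∘ (chartAt B z.proj).symm) w.1)) := by
  have h1 : ∀ᶠ w in 𝓝 (extChartAt (cotangentModel B) z z),
      w ∈ (extChartAt (cotangentModel B) z).target := extChartAt_target_mem_nhds z
  have h2 : ∀ᶠ w in 𝓝 (extChartAt (cotangentModel B) z z),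
      (extChartAt (cotangentModel B) z).symm w ∈ (extChartAt (cotangentModel B) z₀).source := by
    refine (continuousAt_extChartAt_symm (I := cotangentModel B) z).eventually_mem ?_
    rw [extChartAt_to_inv]
    refine (isOpen_extChartAt_source z₀).mem_nhds ?_
    rw [extChartAt_cotangent_source]
    exact hz
  filter_upwards [h1, h2] with w hw1 hw2
  set z' := (extChartAt (cotangentModel B) z).symm w with hz'
  have hs : z' ∈ (extChartAt (cotangentModel B) z).source :=
    (extChartAt (cotangentModel B) z).map_target hw1
  have hw : cotangentCoord z.proj z' = w := by
    rw [← extChartAt_cotangent_apply]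
    exact (extChartAt (cotangentModel B) z).right_inv hw1
  rw [extChartAt_cotangent_source] at hs hw2
  have hp : (chartAt B z.proj).symm w.1 = z'.proj := by
    rw [← hw]
    exact (chartAt B z.proj).left_inv hs
  change extChartAt (cotangentModel B) z₀ z' = _
  rw [extChartAt_cotangent_apply]
  refine Prod.ext ?_ ?_
  · change chartAt B z₀.proj z'.proj = chartAt B z₀.proj ((chartAt B z.proj).symm w.1)
    rw [hp]
  · rw [cotangentCoord_snd_eq hs hw2, hw]
    simp only [Function.comp_apply]
    rw [hp, tangentCoordChange_def]
    simp [fderivWithin_univ]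

/-- The coordinate changes of `T*M` preserve the canonical form. -/
theorem canonicalForm_tangentCoordChange {z z₀ : CotangentBundle B M}
    (hz : z.proj ∈ (chartAt B z₀.proj).source) (X Y : B × (B →L[ℝ] ℝ)) :
    (tangentCoordChange (cotangentModel B) z z₀ z Y).2
        (tangentCoordChange (cotangentModel B) z z₀ z X).1
      - (tangentCoordChange (cotangentModel B) z z₀ z X).2
        (tangentCoordChange (cotangentModel B) z z₀ z Y).1 = Y.2 X.1 - X.2 Y.1 := by
  have hs : z.proj ∈ (extChartAt 𝓘(ℝ, B) z.proj).source ∩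
      (extChartAt 𝓘(ℝ, B) z₀.proj).source := by
    simp only [extChartAt_source]
    exact ⟨mem_chart_source B z.proj, hz⟩
  have hφ := hasFDerivWithinAt_tangentCoordChange (I := 𝓘(ℝ, B)) hs
  have hD := hasFDerivWithinAt_tangentCoordChange (I := cotangentModel B)
    (x := z) (y := z₀) (z := z) (by
      rw [extChartAt_cotangent_source, extChartAt_cotangent_source]
      exact ⟨mem_chart_source B z.proj, hz⟩)
  have hr : range (cotangentModel B) = univ := by simp
  rw [modelWithCornersSelf_coe, range_id, hasFDerivWithinAt_univ] at hφ
  rw [hr, hasFDerivWithinAt_univ] at hD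
  have hx : (chartAt B z₀.proj ∘ (chartAt B z.proj).symm) (chartAt B z.proj z.proj)
      = chartAt B z₀.proj z.proj :=
    congrArg (chartAt B z₀.proj) ((chartAt B z.proj).left_inv (mem_chart_source B z.proj))
  have hf : fderiv ℝ (chartAt B z.proj ∘ (chartAt B z₀.proj).symm) (chartAt B z₀.proj z.proj)
      = tangentCoordChange 𝓘(ℝ, B) z₀.proj z.proj z.proj := by
    rw [tangentCoordChange_def]
    simp [fderivWithin_univ]
  refine cotangentLift_symplectic (φ := chartAt B z₀.proj ∘ (chartAt B z.proj).symm)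
    (χ := chartAt B z.proj ∘ (chartAt B z₀.proj).symm)
    (z := extChartAt (cotangentModel B) z z) hφ ?_ ?_
    (hD.congr_of_eventuallyEq (cotangentCoord_eventuallyEq hz).symm) X Y
  · change ContDiffAt ℝ 2 _
      ((chartAt B z₀.proj ∘ (chartAt B z.proj).symm) (chartAt B z.proj z.proj))
    rw [hx]
    have h := contDiffWithinAt_ext_coord_change (I := 𝓘(ℝ, B)) (n := ∞) z.proj z₀.proj
      (y := extChartAt 𝓘(ℝ, B) z₀.proj z.proj) (by
        rw [PartialEquiv.trans_source'', PartialEquiv.symm_symm, PartialEquiv.symm_target]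
        exact mem_image_of_mem _ hs.symm)
    rw [modelWithCornersSelf_coe, range_id, contDiffWithinAt_univ] at h
    exact h.of_le (WithTop.coe_le_coe.2 le_top)
  · intro v
    change fderiv ℝ _
      ((chartAt B z₀.proj ∘ (chartAt B z.proj).symm) (chartAt B z.proj z.proj)) _ = v
    rw [hx, hf, tangentCoordChange_comp (I := 𝓘(ℝ, B)) ⟨hs, hs.1⟩,
      tangentCoordChange_self (I := 𝓘(ℝ, B)) hs.1]

end Cotangent

/-! ### The anchor and the metric in a chart and a trivialization. -/

namespace SubRiemannianStructure

variable {B : Type*} [NormedAddCommGroup B] [NormedSpace ℝ B]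
  {M : Type*} [TopologicalSpace M] [ChartedSpace B M] [IsManifold 𝓘(ℝ, B) ∞ M]
  {F : Type*} [NormedAddCommGroup F] [NormedSpace ℝ F]
  {E : M → Type*} [TopologicalSpace (TotalSpace F E)]
  [∀ q, TopologicalSpace (E q)] [∀ q, AddCommGroup (E q)] [∀ q, Module ℝ (E q)]
  [∀ q, IsTopologicalAddGroup (E q)] [∀ q, ContinuousSMul ℝ (E q)]
  [FiberBundle F E] [VectorBundle ℝ F E] [ContMDiffVectorBundle ∞ F E 𝓘(ℝ, B)]
  (S : SubRiemannianStructure B M F E) (x₀ : M)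

/-- The anchor, in the preferred chart and trivialization at `x₀`. -/
def localAnchor (y : B) : F →L[ℝ] B :=
  ContinuousLinearMap.inCoordinates F E B (TangentSpace 𝓘(ℝ, B)) x₀ ((chartAt B x₀).symm y)
    x₀ ((chartAt B x₀).symm y) (S.anchor ((chartAt B x₀).symm y))

/-- The metric, in the preferred chart and trivialization at `x₀`. -/
def localMetric (y : B) : F →L[ℝ] F →L[ℝ] ℝ :=
  ContinuousLinearMap.inCoordinates F E (F →L[ℝ] ℝ) (fun q => E q →L[ℝ] Bundle.Trivial M ℝ q)
    x₀ ((chartAt B x₀).symm y) x₀ ((chartAt B x₀).symm y) (S.metric ((chartAt B x₀).symm y))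

/-- The image in the preferred chart at `x₀` of the common domain of the chart and of the
preferred trivialization of the bundle. -/
def localDomain (_S : SubRiemannianStructure B M F E) (x₀ : M) : Set B :=
  (chartAt B x₀).target ∩ (chartAt B x₀).symm ⁻¹' (trivializationAt F E x₀).baseSet

variable {S x₀} {q : M}

theorem chartAt_mem_localDomain (hq : q ∈ (chartAt B x₀).source)
    (hq' : q ∈ (trivializationAt F E x₀).baseSet) : chartAt B x₀ q ∈ S.localDomain x₀ := by
  refine ⟨(chartAt B x₀).map_source hq, ?_⟩
  rw [mem_preimage, (chartAt B x₀).left_inv hq]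
  exact hq'

theorem isOpen_localDomain : IsOpen (S.localDomain x₀) :=
  (chartAt B x₀).isOpen_inter_preimage_symm (trivializationAt F E x₀).open_baseSet

theorem localAnchor_apply (hq : q ∈ (chartAt B x₀).source)
    (hq' : q ∈ (trivializationAt F E x₀).baseSet) (u : E q) :
    S.localAnchor x₀ (chartAt B x₀ q) (trivializationAt F E x₀ ⟨q, u⟩).2 =
      mfderiv 𝓘(ℝ, B) 𝓘(ℝ, B) (chartAt B x₀) q (S.anchor q u) := by
  rw [localAnchor, (chartAt B x₀).left_inv hq]
  rw [ContinuousLinearMap.inCoordinates_eq hq' (by simpa using hq),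
    mfderiv_chartAt_eq_tangentCoordChange hq]
  simp only [ContinuousLinearMap.comp_apply, ContinuousLinearEquiv.coe_coe]
  rw [show (trivializationAt F E x₀ ⟨q, u⟩).2 =
    (trivializationAt F E x₀).continuousLinearEquivAt ℝ q hq' u from rfl,
    ContinuousLinearEquiv.symm_apply_apply]
  rfl

theorem localMetric_apply (hq : q ∈ (chartAt B x₀).source)
    (hq' : q ∈ (trivializationAt F E x₀).baseSet) (u v : E q) :
    S.localMetric x₀ (chartAt B x₀ q) (trivializationAt F E x₀ ⟨q, u⟩).2
      (trivializationAt F E x₀ ⟨q, v⟩).2 = S.metric q u v := by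
  rw [localMetric, (chartAt B x₀).left_inv hq]
  rw [inCoordinates_apply_eq₂ hq' hq' (by simp)]
  rw [Trivialization.symm_apply_apply_mk _ hq', Trivialization.symm_apply_apply_mk _ hq']
  simp

theorem contDiffOn_localAnchor : ContDiffOn ℝ ∞ (S.localAnchor x₀) (S.localDomain x₀) := by
  rw [← contMDiffOn_iff_contDiffOn]
  intro y hy
  have h1 := (contMDiffOn_chart_symm (I := 𝓘(ℝ, B)) (n := ∞) (x := x₀)).contMDiffAt
    ((chartAt B x₀).open_target.mem_nhds hy.1)
  have h2 := (((trivializationAt (F →L[ℝ] B)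
    (fun q => E q →L[ℝ] TangentSpace 𝓘(ℝ, B) q) x₀).contMDiffAt_section_iff (IB := 𝓘(ℝ, B))
      (n := ∞) (s := S.anchor) (x₀ := (chartAt B x₀).symm y) (by
        rw [hom_trivializationAt_baseSet]
        exact ⟨hy.2, (chartAt B x₀).map_target hy.1⟩)).1
    S.contMDiff_anchor.contMDiffAt)
  exact (h2.comp y h1).contMDiffWithinAt

theorem contDiffOn_localMetric : ContDiffOn ℝ ∞ (S.localMetric x₀) (S.localDomain x₀) := by
  rw [← contMDiffOn_iff_contDiffOn]
  intro y hy
  have h1 := (contMDiffOn_chart_symm (I := 𝓘(ℝ, B)) (n := ∞) (x := x₀)).contMDiffAt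
    ((chartAt B x₀).open_target.mem_nhds hy.1)
  have h2 := (((trivializationAt (F →L[ℝ] F →L[ℝ] ℝ)
    (fun q => E q →L[ℝ] E q →L[ℝ] Bundle.Trivial M ℝ q) x₀).contMDiffAt_section_iff
      (IB := 𝓘(ℝ, B))
      (n := ∞) (s := S.metric) (x₀ := (chartAt B x₀).symm y) (by
        simp only [hom_trivializationAt_baseSet]
        exact ⟨hy.2, hy.2, mem_univ _⟩)).1
    S.contMDiff_metric.contMDiffAt)
  exact (h2.comp y h1).contMDiffWithinAt

/-- At each point the trivialization is a linear homeomorphism of the fibre onto `F` that carries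
the metric to its coordinate expression, so coercivity and the Riesz theorem on the fibre transfer
to `F`. -/
theorem isLocalModel [CompleteSpace F] (hS : S.IsStrong) :
    IsLocalModel (S.localAnchor x₀) (S.localMetric x₀) (S.localDomain x₀) := by
  have key : ∀ y ∈ S.localDomain x₀, ∃ e : E ((chartAt B x₀).symm y) ≃L[ℝ] F,
      ∀ u v, S.localMetric x₀ y (e u) (e v) = S.metric _ u v := by
    intro y hy
    refine ⟨(trivializationAt F E x₀).continuousLinearEquivAt ℝ _ hy.2, fun u v => ?_⟩
    have := localMetric_apply (S := S) ((chartAt B x₀).map_target hy.1) hy.2 u v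
    rwa [(chartAt B x₀).right_inv hy.1] at this
  refine ⟨isOpen_localDomain, contDiffOn_localAnchor, contDiffOn_localMetric, ?_, ?_, ?_⟩
  · intro y hy v w
    obtain ⟨e, he⟩ := key y hy
    have := he (e.symm v) (e.symm w)
    have h' := he (e.symm w) (e.symm v)
    simp only [ContinuousLinearEquiv.apply_symm_apply] at this h'
    rw [this, h', S.metric_symm]
  · intro y hy
    obtain ⟨e, he⟩ := key y hy
    obtain ⟨c, hc, h⟩ := exists_coercive e (hS _)
    refine ⟨c, hc, fun v => ?_⟩
    have := h (e.symm v)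
    have h' := he (e.symm v) (e.symm v)
    simp only [ContinuousLinearEquiv.apply_symm_apply] at this h'
    rwa [h']
  · intro y hy φ
    obtain ⟨e, he⟩ := key y hy
    obtain ⟨u, hu⟩ := exists_eq_apply_of_strong e (S.metric_symm _) (S.metric_pos _) (hS _)
      (φ ∘L (e : E ((chartAt B x₀).symm y) →L[ℝ] F))
    refine ⟨e u, ?_⟩
    ext v
    have h' := he u (e.symm v)
    rw [← hu] at h'
    simpa using h'

end SubRiemannianStructure

/-! ### The normal control and the normal Hamiltonian on $T^*M$. -/

namespace SubRiemannianStructure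

variable {B : Type*} [NormedAddCommGroup B] [NormedSpace ℝ B]
  {M : Type*} [TopologicalSpace M] [ChartedSpace B M] [IsManifold 𝓘(ℝ, B) ∞ M]
  {F : Type*} [NormedAddCommGroup F] [NormedSpace ℝ F]
  {E : M → Type*} [TopologicalSpace (TotalSpace F E)]
  [∀ q, TopologicalSpace (E q)] [∀ q, AddCommGroup (E q)] [∀ q, Module ℝ (E q)]
  [∀ q, IsTopologicalAddGroup (E q)] [∀ q, ContinuousSMul ℝ (E q)]
  [FiberBundle F E] [VectorBundle ℝ F E] [ContMDiffVectorBundle ∞ F E 𝓘(ℝ, B)]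
  {S : SubRiemannianStructure B M F E}

theorem IsNormalControl.eq {z : CotangentBundle B M} {u v : E z.proj}
    (hu : S.IsNormalControl z u) (hv : S.IsNormalControl z v) : u = v := by
  by_contra h
  have h1 := S.metric_pos z.proj (u - v) (sub_ne_zero.2 h)
  have h2 : S.metric z.proj (u - v) (u - v) = 0 := by
    rw [map_sub (S.metric z.proj), _root_.sub_apply, ← hu, ← hv, sub_self]
  exact h1.ne' h2

theorem metric_nonneg (q : M) (u : E q) : 0 ≤ S.metric q u u := by
  rcases eq_or_ne u 0 with rfl | h
  · simp
  · exact (S.metric_pos q u h).le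

/-- Completing the square: $H^1(v)=\frac12g(u,u)-\frac12g(u-v,u-v)$. -/
theorem IsNormalControl.isGreatest {z : CotangentBundle B M} {u : E z.proj}
    (hu : S.IsNormalControl z u) :
    IsGreatest (range (S.preHamiltonian z)) (1 / 2 * S.metric z.proj u u) := by
  refine ⟨⟨u, ?_⟩, ?_⟩
  · rw [preHamiltonian, hu u]
    ring
  · rintro _ ⟨v, rfl⟩
    have h := S.metric_nonneg z.proj (u - v)
    rw [map_sub (S.metric z.proj), _root_.sub_apply, map_sub, map_sub,
      S.metric_symm z.proj v u] at h
    rw [preHamiltonian, hu v]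
    linarith

section

variable [CompleteSpace F] (hS : S.IsStrong)
include hS

theorem exists_isNormalControl (z : CotangentBundle B M) : ∃ u, S.IsNormalControl z u :=
  exists_eq_apply_of_strong
    ((trivializationAt F E z.proj).continuousLinearEquivAt ℝ z.proj
      (FiberBundle.mem_baseSet_trivializationAt' z.proj))
    (S.metric_symm _) (S.metric_pos _) (hS _)
    ((z.snd : TangentSpace 𝓘(ℝ, B) z.proj →L[ℝ] ℝ) ∘L S.anchor z.proj)

theorem isNormalControl_normalControl (z : CotangentBundle B M) :
    S.IsNormalControl z (S.normalControl z) :=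
  Classical.epsilon_spec (exists_isNormalControl hS z)

theorem isGreatest_normalHamiltonian (z : CotangentBundle B M) :
    IsGreatest (range (S.preHamiltonian z)) (S.normalHamiltonian z) :=
  (isNormalControl_normalControl hS z).isGreatest

theorem normalHamiltonian_eq_preHamiltonian (z : CotangentBundle B M) :
    S.normalHamiltonian z = S.preHamiltonian z (S.normalControl z) := by
  rw [preHamiltonian, isNormalControl_normalControl hS z, normalHamiltonian]
  ring

end

variable {x₀ : M} {z : CotangentBundle B M}

theorem cotangentCoord_snd_localAnchor (hz : z.proj ∈ (chartAt B x₀).source)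
    (hz' : z.proj ∈ (trivializationAt F E x₀).baseSet) (u : E z.proj) :
    (cotangentCoord x₀ z).2 (S.localAnchor x₀ (cotangentCoord x₀ z).1
      (trivializationAt F E x₀ ⟨z.proj, u⟩).2) = z.snd (S.anchor z.proj u) := by
  change (cotangentCoord x₀ z).2 (S.localAnchor x₀ (chartAt B x₀ z.proj) _) = _
  rw [localAnchor_apply hz hz', mfderiv_chartAt_eq_tangentCoordChange hz]
  change z.snd ((trivializationAt B (TangentSpace 𝓘(ℝ, B)) x₀).symmL ℝ z.proj
    ((trivializationAt B (TangentSpace 𝓘(ℝ, B)) x₀ ⟨z.proj, S.anchor z.proj u⟩).2)) = _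
  congr 1
  rw [Trivialization.symmL_apply _ (by exact hz)]
  exact Trivialization.symm_apply_apply_mk
    (trivializationAt B (TangentSpace 𝓘(ℝ, B)) x₀) (b := z.proj) hz (S.anchor z.proj u)

section

variable [CompleteSpace F] (hS : S.IsStrong)
include hS

/-- The normal control, in coordinates. -/
theorem trivializationAt_normalControl (hz : z.proj ∈ (chartAt B x₀).source)
    (hz' : z.proj ∈ (trivializationAt F E x₀).baseSet) :
    (trivializationAt F E x₀ ⟨z.proj, S.normalControl z⟩).2 =
      localControl (S.localAnchor x₀) (S.localMetric x₀) (cotangentCoord x₀ z) := by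
  refine (isLocalModel hS).eq_localControl (chartAt_mem_localDomain hz hz') fun v => ?_
  obtain ⟨v, rfl⟩ : ∃ w : E z.proj, (trivializationAt F E x₀ ⟨z.proj, w⟩).2 = v :=
    ((trivializationAt F E x₀).continuousLinearEquivAt ℝ z.proj hz').surjective v
  rw [cotangentCoord_snd_localAnchor hz hz', isNormalControl_normalControl hS]
  exact (localMetric_apply hz hz' _ _).symm

/-- The normal Hamiltonian, in coordinates. -/
theorem normalHamiltonian_eq_localHamiltonian (hz : z.proj ∈ (chartAt B x₀).source)
    (hz' : z.proj ∈ (trivializationAt F E x₀).baseSet) :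
    S.normalHamiltonian z =
      localHamiltonian (S.localAnchor x₀) (S.localMetric x₀) (cotangentCoord x₀ z) := by
  rw [localHamiltonian, ← trivializationAt_normalControl hS hz hz']
  exact congrArg (1 / 2 * ·) (localMetric_apply hz hz' _ _).symm

theorem contMDiff_normalHamiltonian :
    ContMDiff (cotangentModel B) 𝓘(ℝ, ℝ) ∞
      (S.normalHamiltonian : CotangentBundle B M → ℝ) := by
  intro z₀
  have hz₀ : cotangentCoord z₀.proj z₀ ∈ {w | w.1 ∈ S.localDomain z₀.proj} :=
    chartAt_mem_localDomain (S := S) (mem_chart_source B z₀.proj)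
      (FiberBundle.mem_baseSet_trivializationAt' z₀.proj)
  have h1 := ((isLocalModel (x₀ := z₀.proj) hS).contDiffAt_localHamiltonian hz₀).contMDiffAt
  rw [← extChartAt_cotangent_apply] at h1
  refine (h1.comp z₀ (contMDiffAt_extChartAt (I := cotangentModel B))).congr_of_eventuallyEq ?_
  have hc : Continuous (fun z : CotangentBundle B M => z.proj) :=
    FiberBundle.continuous_proj _ _
  filter_upwards [hc.continuousAt.eventually_mem (chart_source_mem_nhds B z₀.proj),
    hc.continuousAt.eventually_mem ((trivializationAt F E z₀.proj).open_baseSet.mem_nhds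
      (FiberBundle.mem_baseSet_trivializationAt' z₀.proj))] with z hz hz'
  rw [Function.comp_apply, extChartAt_cotangent_apply]
  exact normalHamiltonian_eq_localHamiltonian hS hz hz'

end

end SubRiemannianStructure

/-! ### Weak nondegeneracy of the symplectic form; $T^*M$ is Hausdorff. -/

section

variable {B : Type*} [NormedAddCommGroup B] [NormedSpace ℝ B]
  {M : Type*} [TopologicalSpace M] [ChartedSpace B M] [IsManifold 𝓘(ℝ, B) ∞ M]

/-- Testing on $(v,0)$ determines the covector component; testing on $(0,f)$ determines the vector
component because functionals separate points (Hahn–Banach). -/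
theorem canonicalForm_left_injective {z : CotangentBundle B M}
    {X X' : TangentSpace (cotangentModel B) z}
    (h : ∀ Y, canonicalForm z X Y = canonicalForm z X' Y) : X = X' := by
  have h1 : (X : B × (B →L[ℝ] ℝ)).2 = (X' : B × (B →L[ℝ] ℝ)).2 := by
    ext v
    have := h (show B × (B →L[ℝ] ℝ) from (v, 0))
    simp only [canonicalForm] at this
    change (0 : B →L[ℝ] ℝ) _ - _ = (0 : B →L[ℝ] ℝ) _ - _ at this
    simpa using this
  refine Prod.ext ?_ h1
  refine (SeparatingDual.eq_iff_forall_dual_eq (R := ℝ)).2 fun f => ?_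
  have := h (show B × (B →L[ℝ] ℝ) from (0, f))
  simp only [canonicalForm] at this
  change f _ - (X : B × (B →L[ℝ] ℝ)).2 0 = f _ - (X' : B × (B →L[ℝ] ℝ)).2 0 at this
  simpa using this

theorem IsSymplecticGradient.eq {f : CotangentBundle B M → ℝ} {z : CotangentBundle B M}
    {X X' : TangentSpace (cotangentModel B) z} (h : IsSymplecticGradient f z X)
    (h' : IsSymplecticGradient f z X') : X = X' :=
  canonicalForm_left_injective fun Y => (h.2 Y).symm.trans (h'.2 Y)

/-- Needed for the uniqueness of integral curves. Two covectors over one point are separated inside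
a trivialization, all others by their base points. -/
instance [T2Space M] : T2Space (CotangentBundle B M) := by
  refine ⟨fun z w hzw => ?_⟩
  by_cases h : z.proj = w.proj
  · set e := trivializationAt (B →L[ℝ] ℝ)
      (fun q : M => TangentSpace 𝓘(ℝ, B) q →L[ℝ] Bundle.Trivial M ℝ q) z.proj with he
    have hz : z ∈ e.source := FiberBundle.mem_trivializationAt_proj_source
    have hw : w ∈ e.source := by
      rw [Trivialization.mem_source] at hz ⊢
      rwa [← h]
    obtain ⟨u, v, hu, hv, hzu, hwv, huv⟩ :=
      t2_separation (fun h' => hzw (e.injOn hz hw h') : e z ≠ e w)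
    exact ⟨_, _, e.continuousOn_toFun.isOpen_inter_preimage e.open_source hu,
      e.continuousOn_toFun.isOpen_inter_preimage e.open_source hv, ⟨hz, hzu⟩, ⟨hw, hwv⟩,
      (huv.preimage _).mono inter_subset_right inter_subset_right⟩
  · obtain ⟨u, v, hu, hv, hzu, hwv, huv⟩ := t2_separation h
    exact ⟨_, _, hu.preimage (FiberBundle.continuous_proj _ _),
      hv.preimage (FiberBundle.continuous_proj _ _), hzu, hwv, huv.preimage _⟩

end

/-! ### The symplectic gradient of the normal Hamiltonian. -/

namespace SubRiemannianStructure

variable {B : Type*} [NormedAddCommGroup B] [NormedSpace ℝ B]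
  {M : Type*} [TopologicalSpace M] [ChartedSpace B M] [IsManifold 𝓘(ℝ, B) ∞ M]
  {F : Type*} [NormedAddCommGroup F] [NormedSpace ℝ F]
  {E : M → Type*} [TopologicalSpace (TotalSpace F E)]
  [∀ q, TopologicalSpace (E q)] [∀ q, AddCommGroup (E q)] [∀ q, Module ℝ (E q)]
  [∀ q, IsTopologicalAddGroup (E q)] [∀ q, ContinuousSMul ℝ (E q)]
  [FiberBundle F E] [VectorBundle ℝ F E] [ContMDiffVectorBundle ∞ F E 𝓘(ℝ, B)]
  {S : SubRiemannianStructure B M F E} [CompleteSpace F] (hS : S.IsStrong)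
  {z₀ z : CotangentBundle B M}
include hS

theorem mfderiv_normalHamiltonian (hz : z.proj ∈ (chartAt B z₀.proj).source)
    (hz' : z.proj ∈ (trivializationAt F E z₀.proj).baseSet) (Y : B × (B →L[ℝ] ℝ)) :
    mfderiv (cotangentModel B) 𝓘(ℝ, ℝ) S.normalHamiltonian z Y =
      fderiv ℝ (localHamiltonian (S.localAnchor z₀.proj) (S.localMetric z₀.proj))
        (cotangentCoord z₀.proj z) (tangentCoordChange (cotangentModel B) z z₀ z Y) := by
  have hd : MDifferentiableAt (cotangentModel B) 𝓘(ℝ, ℝ) S.normalHamiltonian z :=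
    (contMDiff_normalHamiltonian hS).mdifferentiable (by simp) z
  have hr : range (cotangentModel B) = univ := by simp
  have hD := hasFDerivWithinAt_tangentCoordChange (I := cotangentModel B)
    (x := z) (y := z₀) (z := z) (by
      rw [extChartAt_cotangent_source, extChartAt_cotangent_source]
      exact ⟨mem_chart_source B z.proj, hz⟩)
  rw [hr, hasFDerivWithinAt_univ] at hD
  have hL := (((isLocalModel (x₀ := z₀.proj) hS).contDiffAt_localHamiltonian
    (z := cotangentCoord z₀.proj z)
    (chartAt_mem_localDomain hz hz')).differentiableAt (by simp)).hasFDerivAt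
  have h0 : (extChartAt (cotangentModel B) z₀ ∘ (extChartAt (cotangentModel B) z).symm)
      (extChartAt (cotangentModel B) z z) = cotangentCoord z₀.proj z := by
    rw [Function.comp_apply, extChartAt_to_inv, extChartAt_cotangent_apply]
  rw [← h0] at hL
  have hcomp := hL.comp _ hD
  rw [h0] at hcomp
  have hc : Continuous (fun z : CotangentBundle B M => z.proj) :=
    FiberBundle.continuous_proj _ _
  have hev : (S.normalHamiltonian ∘ (extChartAt (cotangentModel B) z).symm) =ᶠ[
      𝓝 (extChartAt (cotangentModel B) z z)]
      localHamiltonian (S.localAnchor z₀.proj) (S.localMetric z₀.proj) ∘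
        (extChartAt (cotangentModel B) z₀ ∘ (extChartAt (cotangentModel B) z).symm) := by
    have h1 := continuousAt_extChartAt_symm (I := cotangentModel B) z
    have h2 := hc.continuousAt.comp h1
    filter_upwards [h2.eventually_mem (s := (chartAt B z₀.proj).source) (by
        simp only [Function.comp_apply, extChartAt_to_inv]
        exact (chartAt B z₀.proj).open_source.mem_nhds hz),
      h2.eventually_mem (s := (trivializationAt F E z₀.proj).baseSet) (by
        simp only [Function.comp_apply, extChartAt_to_inv]
        exact (trivializationAt F E z₀.proj).open_baseSet.mem_nhds hz')] with w hw hw'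
    simp only [Function.comp_apply]
    rw [extChartAt_cotangent_apply]
    exact normalHamiltonian_eq_localHamiltonian hS hw hw'
  have := (hcomp.congr_of_eventuallyEq hev).fderiv
  rw [hd.mfderiv, hr, fderivWithin_univ]
  exact congrArg (fun L : B × (B →L[ℝ] ℝ) →L[ℝ] ℝ => L Y) this

/-- The symplectic gradient of the normal Hamiltonian is the Hamiltonian vector field of its
expression in coordinates. -/
theorem isSymplecticGradient_normalHamiltonian (hz : z.proj ∈ (chartAt B z₀.proj).source)
    (hz' : z.proj ∈ (trivializationAt F E z₀.proj).baseSet) :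
    IsSymplecticGradient S.normalHamiltonian z (tangentCoordChange (cotangentModel B) z₀ z z
      (localField (S.localAnchor z₀.proj) (S.localMetric z₀.proj) (cotangentCoord z₀.proj z))) := by
  refine ⟨(contMDiff_normalHamiltonian hS).mdifferentiable (by simp) z, fun Y => ?_⟩
  refine (mfderiv_normalHamiltonian hS hz hz' Y).trans ?_
  rw [(isLocalModel hS).fderiv_localHamiltonian (chartAt_mem_localDomain hz hz')]
  have h1 : z ∈ (extChartAt (cotangentModel B) z₀).source ∩
      (extChartAt (cotangentModel B) z).source := by
    rw [extChartAt_cotangent_source, extChartAt_cotangent_source]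
    exact ⟨hz, mem_chart_source B z.proj⟩
  -- The Hamiltonian identity holds in the chart at `z₀`, whereas `canonicalForm` is read in the
  -- chart at `z`; invariance of the form carries one to the other.
  have h2 := canonicalForm_tangentCoordChange hz
    (tangentCoordChange (cotangentModel B) z₀ z z
      (localField (S.localAnchor z₀.proj) (S.localMetric z₀.proj) (cotangentCoord z₀.proj z))) Y
  rw [tangentCoordChange_comp ⟨h1, h1.1⟩, tangentCoordChange_self h1.1] at h2
  exact h2

theorem isSymplecticGradient_symplecticGradient (z : CotangentBundle B M) :
    IsSymplecticGradient S.normalHamiltonian z (symplecticGradient S.normalHamiltonian z) :=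
  Classical.epsilon_spec (p := IsSymplecticGradient S.normalHamiltonian z)
    ⟨_, isSymplecticGradient_normalHamiltonian hS (z₀ := z) (mem_chart_source B z.proj)
      (FiberBundle.mem_baseSet_trivializationAt' z.proj)⟩

/-- The symplectic gradient of the normal Hamiltonian, in coordinates. -/
theorem tangentCoordChange_symplecticGradient (hz : z.proj ∈ (chartAt B z₀.proj).source)
    (hz' : z.proj ∈ (trivializationAt F E z₀.proj).baseSet) :
    tangentCoordChange (cotangentModel B) z z₀ z (symplecticGradient S.normalHamiltonian z) =
      localField (S.localAnchor z₀.proj) (S.localMetric z₀.proj) (cotangentCoord z₀.proj z) := by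
  have h1 : z ∈ (extChartAt (cotangentModel B) z₀).source ∩
      (extChartAt (cotangentModel B) z).source := by
    rw [extChartAt_cotangent_source, extChartAt_cotangent_source]
    exact ⟨hz, mem_chart_source B z.proj⟩
  rw [(isSymplecticGradient_symplecticGradient hS z).eq
    (isSymplecticGradient_normalHamiltonian hS hz hz')]
  rw [tangentCoordChange_comp ⟨h1, h1.1⟩, tangentCoordChange_self h1.1]

/-- Class $C^1$ is the regularity that local existence and uniqueness of integral curves ask for. -/
theorem contMDiff_symplecticGradient :
    ContMDiff (cotangentModel B) (cotangentModel B).tangent 1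
      (fun z : CotangentBundle B M =>
        (⟨z, symplecticGradient S.normalHamiltonian z⟩ : TangentBundle (cotangentModel B) _)) := by
  intro z₀
  rw [contMDiffAt_totalSpace]
  refine ⟨contMDiffAt_id, ?_⟩
  have hz₀ : cotangentCoord z₀.proj z₀ ∈ {w | w.1 ∈ S.localDomain z₀.proj} :=
    chartAt_mem_localDomain (S := S) (mem_chart_source B z₀.proj)
      (FiberBundle.mem_baseSet_trivializationAt' z₀.proj)
  have h1 := (((isLocalModel (x₀ := z₀.proj) hS).contDiffAt_localField hz₀).of_le
    (show (1 : WithTop ℕ∞) ≤ (∞ : WithTop ℕ∞) by simp)).contMDiffAt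
  rw [← extChartAt_cotangent_apply] at h1
  refine (h1.comp z₀ (contMDiffAt_extChartAt (I := cotangentModel B))).congr_of_eventuallyEq ?_
  have hc : Continuous (fun z : CotangentBundle B M => z.proj) :=
    FiberBundle.continuous_proj _ _
  filter_upwards [hc.continuousAt.eventually_mem (chart_source_mem_nhds B z₀.proj),
    hc.continuousAt.eventually_mem ((trivializationAt F E z₀.proj).open_baseSet.mem_nhds
      (FiberBundle.mem_baseSet_trivializationAt' z₀.proj))] with z hz hz'
  rw [Function.comp_apply, extChartAt_cotangent_apply]
  exact tangentCoordChange_symplecticGradient hS hz hz'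

end SubRiemannianStructure

/-! ### Integral curves on arbitrary intervals and maximal solutions. -/

section IntegralCurves

variable {V : Type*} [NormedAddCommGroup V] [NormedSpace ℝ V]
  {H : Type*} [TopologicalSpace H] {I : ModelWithCorners ℝ V H}
  {N : Type*} [TopologicalSpace N] [ChartedSpace H N]
  {v : (x : N) → TangentSpace I x} {γ γ₁ γ₂ : ℝ → N} {J : Set ℝ} {t t₀ : ℝ}

theorem _root_.IsMIntegralCurveOn.congr_of_eqOn (h : IsMIntegralCurveOn γ v J)
    (he : EqOn γ₁ γ J) : IsMIntegralCurveOn γ₁ v J := fun t ht => by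
  rw [he ht]
  exact (h t ht).congr_of_eventuallyEq (eventually_nhdsWithin_of_forall he) (he ht)

/-- Gluing of a solution up to `t` and a solution from `t` on. -/
theorem _root_.IsMIntegralCurveOn.glue {a b : ℝ} (h₁ : IsMIntegralCurveOn γ₁ v (Ioc a t))
    (h₂ : IsMIntegralCurveOn γ₂ v (Ico t b)) (h : γ₁ t = γ₂ t) (ha : a < t) (hb : t < b) :
    IsMIntegralCurveOn (fun s => if s ≤ t then γ₁ s else γ₂ s) v (Ioo a b) := by
  set γ := fun s => if s ≤ t then γ₁ s else γ₂ s with hγ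
  have e₁ : EqOn γ γ₁ (Ioc a t) := fun s hs => if_pos hs.2
  have e₂ : EqOn γ γ₂ (Ico t b) := by
    intro s hs
    rcases hs.1.eq_or_lt with rfl | h'
    · exact (if_pos le_rfl).trans h
    · exact if_neg h'.not_ge
  have k₁ := h₁.congr_of_eqOn e₁
  have k₂ := h₂.congr_of_eqOn e₂
  intro s hs
  rcases lt_trichotomy s t with hst | rfl | hst
  · exact ((k₁ s ⟨hs.1, hst.le⟩).hasMFDerivAt
      (Ioc_mem_nhds hs.1 hst)).hasMFDerivWithinAt
  · have := (k₁ s ⟨ha, le_rfl⟩).union (k₂ s ⟨le_rfl, hb⟩)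
    rwa [Ioc_union_Ico_eq_Ioo ha hb] at this
  · exact ((k₂ s ⟨hst.le, hs.2⟩).hasMFDerivAt
      (Ico_mem_nhds hst hs.2)).hasMFDerivWithinAt

variable [IsManifold I 1 N] [BoundarylessManifold I N] [CompleteSpace V]
  (hv : ContMDiff I I.tangent 1 (fun x => (⟨x, v x⟩ : TangentBundle I N)))
include hv

/-- A solution on an interval extends, near each point of the interval, to a solution on a
neighbourhood of this point. -/
theorem _root_.IsMIntegralCurveOn.exists_extension (hγ : IsMIntegralCurveOn γ v J)
    (hJ : J.OrdConnected) (ht : t ∈ J) :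
    ∃ (γ' : ℝ → N) (ε : ℝ), 0 < ε ∧ IsMIntegralCurveOn γ' v (Ioo (t - ε) (t + ε)) ∧
      EqOn γ' γ (J ∩ Ioo (t - ε) (t + ε)) := by
  obtain ⟨β, hβt, hβ⟩ := exists_isMIntegralCurveAt_of_contMDiffAt_boundaryless t
    (hv.contMDiffAt (x := γ t))
  obtain ⟨ε₀, hε₀, hβ⟩ := isMIntegralCurveAt_iff'.1 hβ
  rw [Real.ball_eq_Ioo] at hβ
  -- To the right of $t$ keep $\gamma$ if $J$ continues there; if $t$ is the right end of $J$, use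
  -- the local solution $\beta$ through $\gamma(t)$. The left side is symmetric.
  have hr : ∃ (κ : ℝ → N) (ε : ℝ), 0 < ε ∧ IsMIntegralCurveOn κ v (Ico t (t + ε)) ∧
      EqOn κ γ (J ∩ Ico t (t + ε)) := by
    by_cases h : ∃ t' ∈ J, t < t'
    · obtain ⟨t', ht', htt'⟩ := h
      refine ⟨γ, t' - t, by linarith, hγ.mono fun s hs => hJ.out ht ht' ⟨hs.1, ?_⟩,
        fun s _ => rfl⟩
      linarith [hs.2]
    · push Not at h
      refine ⟨β, ε₀, hε₀, hβ.mono fun s hs => ⟨by linarith [hs.1], hs.2⟩, fun s hs => ?_⟩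
      rw [le_antisymm (h s hs.1) hs.2.1, hβt]
  have hl : ∃ (κ : ℝ → N) (ε : ℝ), 0 < ε ∧ IsMIntegralCurveOn κ v (Ioc (t - ε) t) ∧
      EqOn κ γ (J ∩ Ioc (t - ε) t) := by
    by_cases h : ∃ t' ∈ J, t' < t
    · obtain ⟨t', ht', htt'⟩ := h
      refine ⟨γ, t - t', by linarith, hγ.mono fun s hs => hJ.out ht' ht ⟨?_, hs.2⟩,
        fun s _ => rfl⟩
      linarith [hs.1]
    · push Not at h
      refine ⟨β, ε₀, hε₀, hβ.mono fun s hs => ⟨hs.1, by linarith [hs.2]⟩, fun s hs => ?_⟩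
      rw [le_antisymm hs.2.2 (h s hs.1), hβt]
  obtain ⟨κ₂, ε₂, hε₂, hκ₂, he₂⟩ := hr
  obtain ⟨κ₁, ε₁, hε₁, hκ₁, he₁⟩ := hl
  have hg := hκ₁.glue hκ₂ ((he₁ ⟨ht, by linarith, le_rfl⟩).trans
    (he₂ ⟨ht, le_rfl, by linarith⟩).symm) (by linarith) (by linarith)
  refine ⟨_, min ε₁ ε₂, lt_min hε₁ hε₂, hg.mono fun s hs => ⟨?_, ?_⟩, fun s hs => ?_⟩
  · linarith [hs.1, min_le_left ε₁ ε₂]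
  · linarith [hs.2, min_le_right ε₁ ε₂]
  · by_cases h : s ≤ t
    · simp only [h, if_true]
      exact he₁ ⟨hs.1, by linarith [hs.2.1, min_le_left ε₁ ε₂], h⟩
    · simp only [h, if_false]
      exact he₂ ⟨hs.1, (not_le.1 h).le, by linarith [hs.2.2, min_le_right ε₁ ε₂]⟩

/-- Solutions on an interval, open or not, are determined by one of their values. -/
theorem _root_.IsMIntegralCurveOn.eqOn_of_ordConnected [T2Space N] (hJ : J.OrdConnected)
    (h₁ : IsMIntegralCurveOn γ₁ v J) (h₂ : IsMIntegralCurveOn γ₂ v J) (ht₀ : t₀ ∈ J)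
    (h : γ₁ t₀ = γ₂ t₀) : EqOn γ₁ γ₂ J := by
  have : PreconnectedSpace J := Subtype.preconnectedSpace hJ.isPreconnected
  have hc : IsClosed {s : J | γ₁ s = γ₂ s} :=
    isClosed_eq (continuousOn_iff_continuous_domRestrict.1 h₁.continuousOn)
      (continuousOn_iff_continuous_domRestrict.1 h₂.continuousOn)
  -- An end point of $J$ has only one-sided derivatives, so both curves are first extended across it
  -- and local uniqueness is applied to the extensions.
  have ho : IsOpen {s : J | γ₁ s = γ₂ s} := by
    rw [isOpen_iff_mem_nhds]
    intro s hs
    obtain ⟨κ₁, ε₁, hε₁, hκ₁, he₁⟩ := h₁.exists_extension hv hJ s.2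
    obtain ⟨κ₂, ε₂, hε₂, hκ₂, he₂⟩ := h₂.exists_extension hv hJ s.2
    have n₁ : Ioo ((s : ℝ) - ε₁) (s + ε₁) ∈ 𝓝 (s : ℝ) :=
      Ioo_mem_nhds (by linarith) (by linarith)
    have n₂ : Ioo ((s : ℝ) - ε₂) (s + ε₂) ∈ 𝓝 (s : ℝ) :=
      Ioo_mem_nhds (by linarith) (by linarith)
    have hst : κ₁ s = κ₂ s := by
      rw [he₁ ⟨s.2, mem_of_mem_nhds n₁⟩, he₂ ⟨s.2, mem_of_mem_nhds n₂⟩]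
      exact hs
    have hev := isMIntegralCurveAt_eventuallyEq_of_contMDiffAt_boundaryless
      (hv.contMDiffAt (x := κ₁ s)) (hκ₁.isMIntegralCurveAt n₁) (hκ₂.isMIntegralCurveAt n₂) hst
    filter_upwards [continuousAt_subtype_val.eventually hev,
      continuousAt_subtype_val.eventually n₁, continuousAt_subtype_val.eventually n₂]
      with r hr hr₁ hr₂
    exact (he₁ ⟨r.2, hr₁⟩).symm.trans (Eq.trans hr (he₂ ⟨r.2, hr₂⟩))
  have := IsClopen.eq_univ ⟨hc, ho⟩ ⟨⟨t₀, ht₀⟩, h⟩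
  intro s hs
  exact this.symm.subset (mem_univ (⟨s, hs⟩ : J))

/-- A solution on an interval extends to a solution on an interval that is a neighbourhood of a
given point. -/
theorem _root_.IsMIntegralCurveOn.exists_extension_mem_nhds (hγ : IsMIntegralCurveOn γ v J)
    (hJ : J.OrdConnected) (ht : t ∈ J) :
    ∃ (γ' : ℝ → N) (J' : Set ℝ), J'.OrdConnected ∧ IsMIntegralCurveOn γ' v J' ∧
      J ⊆ J' ∧ J' ∈ 𝓝 t ∧ EqOn γ' γ J := by
  classical
  obtain ⟨β, ε, hε, hβ, he⟩ := hγ.exists_extension hv hJ ht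
  set K := Ioo (t - ε) (t + ε) with hK
  set γ' := fun s => if s ∈ K then β s else γ s with hγ'
  have e₁ : EqOn γ' γ J := by
    intro s hs
    by_cases h : s ∈ K
    · exact (if_pos h).trans (he ⟨hs, h⟩)
    · exact if_neg h
  have e₂ : EqOn γ' β K := fun s hs => if_pos hs
  have htK : t ∈ K := ⟨by linarith, by linarith⟩
  refine ⟨γ', J ∪ K, ?_, ?_, subset_union_left, ?_, e₁⟩
  · rw [← isPreconnected_iff_ordConnected]
    exact IsPreconnected.union t ht htK hJ.isPreconnected isPreconnected_Ioo
  · intro s hs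
    by_cases h : s ∈ K
    · exact ((hβ.congr_of_eqOn e₂ s h).hasMFDerivAt (isOpen_Ioo.mem_nhds h)).hasMFDerivWithinAt
    · have hsJ : s ∈ J := hs.resolve_right h
      refine (hγ.congr_of_eqOn e₁ s hsJ).mono_of_mem_nhdsWithin ?_
      rw [mem_nhdsWithin]
      -- A point $s\in J\setminus K$ is at distance at least $\varepsilon$ from $t$, so a point of
      -- $K$ within $\varepsilon$ of $s$ lies between $s$ and $t$, hence in $J$.
      refine ⟨Ioo (s - ε) (s + ε), isOpen_Ioo, ⟨by linarith, by linarith⟩, ?_⟩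
      rintro r ⟨hr, hr' | hr'⟩
      · exact hr'
      · rcases le_or_gt s t with hst | hst
        · have : s ≤ t - ε := by
            by_contra! h'
            exact h ⟨h', by linarith⟩
          exact hJ.out hsJ ht ⟨by linarith [hr'.1], by linarith [hr.2]⟩
        · have : t + ε ≤ s := by
            by_contra! h'
            exact h ⟨by linarith, h'⟩
          exact hJ.out ht hsJ ⟨by linarith [hr.1], by linarith [hr'.2]⟩
  · exact mem_of_superset (isOpen_Ioo.mem_nhds htK) subset_union_right

/-- The maximal solution through a point. -/
theorem exists_maximal_isMIntegralCurveOn [T2Space N] (t₀ : ℝ) (z₀ : N) :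
    ∃ (γ : ℝ → N) (J : Set ℝ), IsOpen J ∧ J.OrdConnected ∧ IsMIntegralCurveOn γ v J ∧ t₀ ∈ J ∧
      γ t₀ = z₀ ∧ ∀ (γ' : ℝ → N) (J' : Set ℝ), J'.OrdConnected → IsMIntegralCurveOn γ' v J' →
        t₀ ∈ J' → γ' t₀ = z₀ → J' ⊆ J ∧ EqOn γ' γ J' := by
  classical
  let P : (ℝ → N) → Set ℝ → Prop := fun γ' J' =>
    J'.OrdConnected ∧ IsMIntegralCurveOn γ' v J' ∧ t₀ ∈ J' ∧ γ' t₀ = z₀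
  have huniq : ∀ γ₁ J₁ γ₂ J₂, P γ₁ J₁ → P γ₂ J₂ → EqOn γ₁ γ₂ (J₁ ∩ J₂) := by
    rintro γ₁ J₁ γ₂ J₂ ⟨o₁, i₁, m₁, e₁⟩ ⟨o₂, i₂, m₂, e₂⟩
    exact IsMIntegralCurveOn.eqOn_of_ordConnected hv (o₁.inter o₂) (i₁.mono inter_subset_left)
      (i₂.mono inter_subset_right) ⟨m₁, m₂⟩ (e₁.trans e₂.symm)
  let J : Set ℝ := {t | ∃ γ' J', P γ' J' ∧ t ∈ J'}
  have : Nonempty N := ⟨z₀⟩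
  -- For each $t$ some solution defined at $t$ is chosen; by `huniq` the diagonal
  -- $t\mapsto\Gamma_t(t)$ agrees with every solution on its domain.
  choose! Γ K hP hm using fun t (ht : t ∈ J) => ht
  let γ : ℝ → N := fun t => Γ t t
  have hγ : ∀ γ' J', P γ' J' → J' ⊆ J ∧ EqOn γ' γ J' := by
    intro γ' J' h
    have hs : J' ⊆ J := fun t ht => ⟨γ', J', h, ht⟩
    exact ⟨hs, fun t ht => huniq _ _ _ _ h (hP t (hs ht)) ⟨ht, hm t (hs ht)⟩⟩
  have hnhds : ∀ t ∈ J, ∃ γ' J', P γ' J' ∧ J' ∈ 𝓝 t := by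
    rintro t ⟨γ', J', ⟨o, i, m, e⟩, ht⟩
    obtain ⟨γ'', J'', o', i', hJJ, hn, he⟩ := i.exists_extension_mem_nhds hv o ht
    exact ⟨γ'', J'', ⟨o', i', hJJ m, (he m).trans e⟩, hn⟩
  obtain ⟨β, hβt, hβ⟩ := exists_isMIntegralCurveAt_of_contMDiffAt_boundaryless t₀
    (hv.contMDiffAt (x := z₀))
  obtain ⟨ε, hε, hβ⟩ := isMIntegralCurveAt_iff'.1 hβ
  have ht₀ : t₀ ∈ Metric.ball t₀ ε := Metric.mem_ball_self hε
  have h0 : P β (Metric.ball t₀ ε) := by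
    refine ⟨?_, hβ, ht₀, hβt⟩
    rw [Real.ball_eq_Ioo]
    exact ordConnected_Ioo
  refine ⟨γ, J, ?_, ?_, ?_, (hγ _ _ h0).1 ht₀,
    ((hγ _ _ h0).2 ht₀).symm.trans hβt, ?_⟩
  · rw [isOpen_iff_mem_nhds]
    intro t ht
    obtain ⟨γ', J', h, hn⟩ := hnhds t ht
    exact mem_of_superset hn (hγ _ _ h).1
  · have : J = ⋃ p : {p : (ℝ → N) × Set ℝ // P p.1 p.2}, p.1.2 := by
      ext t
      simp only [J, mem_ofPred_eq, mem_iUnion]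
      exact ⟨fun ⟨γ', J', h, ht⟩ => ⟨⟨⟨γ', J'⟩, h⟩, ht⟩, fun ⟨p, ht⟩ => ⟨_, _, p.2, ht⟩⟩
    rw [← isPreconnected_iff_ordConnected, this]
    exact isPreconnected_iUnion ⟨t₀, mem_iInter.2 fun p => p.2.2.2.1⟩
      fun p => p.2.1.isPreconnected
  · intro t ht
    obtain ⟨γ', J', h, hn⟩ := hnhds t ht
    exact ((h.2.1.congr_of_eqOn (hγ _ _ h).2.symm t (mem_of_mem_nhds hn)).hasMFDerivAt
      hn).hasMFDerivWithinAt
  · exact fun γ' J' o i m e => hγ γ' J' ⟨o, i, m, e⟩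

end IntegralCurves

/-! ### Horizontal systems in charts; short curves stay in a chart ball. -/

namespace SubRiemannianStructure

variable {B : Type*} [NormedAddCommGroup B] [NormedSpace ℝ B]
  {M : Type*} [TopologicalSpace M] [ChartedSpace B M] [IsManifold 𝓘(ℝ, B) ∞ M]
  {F : Type*} [NormedAddCommGroup F] [NormedSpace ℝ F]
  {E : M → Type*} [TopologicalSpace (TotalSpace F E)]
  [∀ q, TopologicalSpace (E q)] [∀ q, AddCommGroup (E q)] [∀ q, Module ℝ (E q)]
  [∀ q, IsTopologicalAddGroup (E q)] [∀ q, ContinuousSMul ℝ (E q)]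
  [FiberBundle F E] [VectorBundle ℝ F E] [ContMDiffVectorBundle ∞ F E 𝓘(ℝ, B)]
  {S : SubRiemannianStructure B M F E} {x₀ : M} {c : ℝ → TotalSpace F E}

theorem mem_of_chartAt_mem_localDomain {q : M} (hq : q ∈ (chartAt B x₀).source)
    (h : chartAt B x₀ q ∈ S.localDomain x₀) : q ∈ (trivializationAt F E x₀).baseSet := by
  have := h.2
  rwa [mem_preimage, (chartAt B x₀).left_inv hq] at this

/-- The length, in coordinates. -/
theorem IsHorizontalOn.length_eq [CompleteSpace F] (hS : S.IsStrong)
    (hc : S.IsHorizontalOn c 0 1)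
    (h : ∀ s ∈ Icc (0 : ℝ) 1, (c s).proj ∈ (chartAt B x₀).source)
    (h' : ∀ s ∈ Icc (0 : ℝ) 1, (c s).proj ∈ (trivializationAt F E x₀).baseSet) :
    S.length c 0 1 = ENNReal.ofReal (∫ r in (0 : ℝ)..1,
      √(S.localMetric x₀ (chartAt B x₀ (c r).proj) (trivializationAt F E x₀ (c r)).2
        (trivializationAt F E x₀ (c r)).2)) := by
  have hx : ContinuousOn (fun s => chartAt B x₀ (c s).proj) (Icc 0 1) :=
    (chartAt B x₀).continuousOn.comp hc.continuousOn h
  have hG : ContinuousOn (fun s => S.localMetric x₀ (chartAt B x₀ (c s).proj)) (Icc 0 1) :=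
    (isLocalModel hS).contDiffOn_metric.continuousOn.comp hx
      fun s hs => chartAt_mem_localDomain (h s hs) (h' s hs)
  have hu : IntegrableOn (fun r => (trivializationAt F E x₀ (c r)).2) (Icc 0 1) :=
    (hc.memLp_control x₀ 0 1 le_rfl zero_le_one le_rfl h').integrable (by norm_num)
  rw [length, intervalIntegral.integral_of_le zero_le_one, ← integral_Icc_eq_integral_Ioc,
    ofReal_integral_eq_lintegral_ofReal (hG.integrableOn_sqrt_apply₂ hu)
      (Eventually.of_forall fun _ => Real.sqrt_nonneg _)]
  refine setLIntegral_congr_fun measurableSet_Icc fun s hs => ?_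
  exact congrArg (fun a => ENNReal.ofReal √a)
    (localMetric_apply (h s hs) (h' s hs) (c s).snd (c s).snd).symm

variable {y₀ : B} {r K : ℝ}

/-- The trajectory of a horizontal system, in coordinates. -/
theorem IsHorizontalOn.sub_eq_integral {a b : ℝ} (hc : S.IsHorizontalOn c a b) {s t : ℝ}
    (hs : a ≤ s) (hst : s ≤ t) (ht : t ≤ b)
    (h : ∀ τ ∈ Icc s t, (c τ).proj ∈ (chartAt B x₀).source)
    (h' : ∀ τ ∈ Icc s t, (c τ).proj ∈ (trivializationAt F E x₀).baseSet) :
    chartAt B x₀ (c t).proj - chartAt B x₀ (c s).proj =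
      ∫ τ in s..t, S.localAnchor x₀ (chartAt B x₀ (c τ).proj)
        (trivializationAt F E x₀ (c τ)).2 := by
  refine (hc.integral_velocity x₀ s t hs hst ht h).trans
    (intervalIntegral.integral_congr fun τ hτ => ?_)
  rw [uIcc_of_le hst] at hτ
  exact (localAnchor_apply (h τ hτ) (h' τ hτ) (c τ).snd).symm

/-- Displacement in the chart is controlled by length. The estimate stays with lower integrals, so
measurability of the speed plays no role. -/
theorem IsHorizontalOn.enorm_sub_le (hr : Metric.ball y₀ r ⊆ S.localDomain x₀)
    (hK : ∀ y ∈ Metric.ball y₀ r, ∀ v,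
      ‖S.localAnchor x₀ y v‖ ≤ K * √(S.localMetric x₀ y v v))
    (hc : S.IsHorizontalOn c 0 1) {s t : ℝ} (hs : 0 ≤ s) (hst : s ≤ t) (ht : t ≤ 1)
    (h : ∀ τ ∈ Icc s t, (c τ).proj ∈ (chartAt B x₀).source)
    (h' : ∀ τ ∈ Icc s t, chartAt B x₀ (c τ).proj ∈ Metric.ball y₀ r) :
    ‖chartAt B x₀ (c t).proj - chartAt B x₀ (c s).proj‖ₑ ≤ ENNReal.ofReal K *
      ∫⁻ τ in Ioc s t, ENNReal.ofReal √(S.metric (c τ).proj (c τ).snd (c τ).snd) := by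
  have hb : ∀ τ ∈ Icc s t, (c τ).proj ∈ (trivializationAt F E x₀).baseSet :=
    fun τ hτ => mem_of_chartAt_mem_localDomain (h τ hτ) (hr (h' τ hτ))
  rw [hc.sub_eq_integral hs hst ht h hb, intervalIntegral.integral_of_le hst]
  refine (enorm_integral_le_lintegral_enorm _).trans ?_
  rw [← lintegral_const_mul' _ _ ENNReal.ofReal_ne_top]
  refine setLIntegral_mono' measurableSet_Ioc fun τ hτ => ?_
  have hτ := Ioc_subset_Icc_self hτ
  have h1 := hK _ (h' τ hτ) (trivializationAt F E x₀ (c τ)).2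
  have h3 := localMetric_apply (S := S) (h τ hτ) (hb τ hτ) (c τ).snd (c τ).snd
  change S.localMetric x₀ _ (trivializationAt F E x₀ (c τ)).2
    (trivializationAt F E x₀ (c τ)).2 = _ at h3
  rw [h3] at h1
  rw [← ENNReal.ofReal_mul' (Real.sqrt_nonneg _), ← ofReal_norm]
  exact ENNReal.ofReal_le_ofReal h1

/-- A horizontal curve of small length does not leave a ball of a chart. -/
theorem IsHorizontalOn.mem_ball_of_length_lt [CompleteSpace B] [T2Space M]
    (hr : Metric.ball y₀ r ⊆ S.localDomain x₀) (hr0 : 0 < r) (hK0 : 0 < K)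
    (hK : ∀ y ∈ Metric.ball y₀ r, ∀ v,
      ‖S.localAnchor x₀ y v‖ ≤ K * √(S.localMetric x₀ y v v))
    (hc : S.IsHorizontalOn c 0 1) (h0 : (c 0).proj ∈ (chartAt B x₀).source)
    (h0' : Dist.dist (chartAt B x₀ (c 0).proj) y₀ < r / 2)
    (hl : S.length c 0 1 < ENNReal.ofReal (r / (2 * K))) :
    ∀ s ∈ Icc (0 : ℝ) 1, (c s).proj ∈ (chartAt B x₀).source ∧
      chartAt B x₀ (c s).proj ∈ Metric.ball y₀ r := by
  set ψ := chartAt B x₀ with hψ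
  set V : Set M := ψ.source ∩ ψ ⁻¹' Metric.ball y₀ r with hV
  have hVo : IsOpen V := ψ.isOpen_inter_preimage Metric.isOpen_ball
  by_contra! hex
  have hex : (Icc (0 : ℝ) 1 ∩ (fun s => (c s).proj) ⁻¹' Vᶜ).Nonempty := by
    obtain ⟨s, hs, hs'⟩ := hex
    exact ⟨s, hs, fun h => hs' h.1 h.2⟩
  have hcl : IsClosed (Icc (0 : ℝ) 1 ∩ (fun s => (c s).proj) ⁻¹' Vᶜ) :=
    hc.continuousOn.preimage_isClosed_of_isClosed isClosed_Icc hVo.isClosed_compl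
  -- The first exit time from the chart ball; it exists because the set of times spent outside is
  -- compact.
  obtain ⟨σ, ⟨hσ, hσV⟩, hmin⟩ :=
    (isCompact_Icc.of_isClosed_subset hcl inter_subset_left).exists_isLeast hex
  have hin : ∀ s, 0 ≤ s → s < σ → (c s).proj ∈ V := by
    intro s hs hsσ
    by_contra h
    exact absurd (hmin ⟨⟨hs, hsσ.le.trans hσ.2⟩, h⟩) (not_le.2 hsσ)
  have h0V : (c 0).proj ∈ V := ⟨h0, by
    rw [mem_preimage, Metric.mem_ball]
    linarith⟩
  have hσ0 : 0 < σ := hσ.1.lt_of_ne (by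
    rintro rfl
    exact hσV h0V)
  set f : ℝ → ℝ≥0∞ := fun τ =>
    ENNReal.ofReal √(S.metric (c τ).proj (c τ).snd (c τ).snd) with hf
  have hfin : ∀ A : Set ℝ, A ⊆ Icc 0 1 → ∫⁻ τ in A, f τ ≠ ⊤ := fun A hA =>
    ((lintegral_mono_set hA).trans_lt (hl.trans_le le_top)).ne
  -- Truncating at $1$ makes the length function finite and monotone on all of $\mathbb R$, so that
  -- it has a left limit at $\sigma$.
  set ℓ : ℝ → ℝ := fun s => (∫⁻ τ in Ioc 0 (min s 1), f τ).toReal with hℓ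
  have hsub : ∀ s, Ioc 0 (min s 1) ⊆ Icc (0 : ℝ) 1 := fun s τ hτ =>
    ⟨hτ.1.le, hτ.2.trans (min_le_right _ _)⟩
  have hmono : Monotone ℓ := fun s t hst =>
    ENNReal.toReal_mono (hfin _ (hsub t))
      (lintegral_mono_set (Ioc_subset_Ioc_right (min_le_min_right _ hst)))
  have hdist : ∀ s t, 0 ≤ s → s ≤ t → t < σ →
      Dist.dist (ψ (c t).proj) (ψ (c s).proj) ≤ K * (ℓ t - ℓ s) := by
    intro s t hs hst htσ
    have ht1 : t ≤ 1 := htσ.le.trans hσ.2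
    have h1 := hc.enorm_sub_le hr hK hs hst ht1
      (fun τ hτ => (hin τ (hs.trans hτ.1) (hτ.2.trans_lt htσ)).1)
      (fun τ hτ => (hin τ (hs.trans hτ.1) (hτ.2.trans_lt htσ)).2)
    have h2 : ℓ t - ℓ s = (∫⁻ τ in Ioc s t, f τ).toReal := by
      simp only [hℓ]
      rw [min_eq_left ht1, min_eq_left (hst.trans ht1), ← Ioc_union_Ioc_eq_Ioc hs hst,
        lintegral_union measurableSet_Ioc (Ioc_disjoint_Ioc_of_le le_rfl),
        ENNReal.toReal_add (hfin _ fun τ hτ => ⟨hτ.1.le, hτ.2.trans (hst.trans ht1)⟩)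
          (hfin _ fun τ hτ => ⟨hs.trans hτ.1.le, hτ.2.trans ht1⟩)]
      ring
    have h3 := ENNReal.toReal_mono (ENNReal.mul_ne_top ENNReal.ofReal_ne_top
      (hfin (Ioc s t) fun τ hτ => ⟨hs.trans hτ.1.le, hτ.2.trans ht1⟩)) h1
    rwa [ENNReal.toReal_mul, ENNReal.toReal_ofReal hK0.le, ← h2, toReal_enorm,
      ← dist_eq_norm] at h3
  have hlim := hmono.tendsto_nhdsLT σ
  have hev : ∀ᶠ s in 𝓝[<] σ, 0 ≤ s ∧ s < σ := by
    filter_upwards [Ioo_mem_nhdsLT hσ0] with s hs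
    exact ⟨hs.1.le, hs.2⟩
  -- At time $\sigma$ the curve might be outside the chart, so the limit is built inside: the
  -- oscillation near $\sigma$ is at most $K$ times that of $\ell$, and completeness of `B` gives a
  -- limit point.
  have hcau : Cauchy (map (fun s => ψ (c s).proj) (𝓝[<] σ)) := by
    rw [Metric.cauchy_iff]
    refine ⟨inferInstance, fun ε hε => ?_⟩
    have h1 : ∀ᶠ s in 𝓝[<] σ, Dist.dist (ℓ s) (sSup (ℓ '' Iio σ)) < ε / (2 * K) :=
      hlim.eventually (Metric.ball_mem_nhds _ (by positivity))
    refine ⟨_, image_mem_map (h1.and hev), ?_⟩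
    have key : ∀ s t, s ≤ t → (Dist.dist (ℓ s) (sSup (ℓ '' Iio σ)) < ε / (2 * K) ∧ 0 ≤ s ∧ s < σ) →
        (Dist.dist (ℓ t) (sSup (ℓ '' Iio σ)) < ε / (2 * K) ∧ 0 ≤ t ∧ t < σ) →
        Dist.dist (ψ (c t).proj) (ψ (c s).proj) < ε := by
      rintro s t hst ⟨h1, h2, h3⟩ ⟨h4, h5, h6⟩
      refine (hdist s t h2 hst h6).trans_lt ?_
      have h7 : ℓ t - ℓ s < ε / (2 * K) + ε / (2 * K) := by
        refine (le_abs_self _).trans_lt ?_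
        rw [← Real.dist_eq]
        exact (dist_triangle_right _ _ _).trans_lt (add_lt_add h4 h1)
      calc K * (ℓ t - ℓ s) < K * (ε / (2 * K) + ε / (2 * K)) := mul_lt_mul_of_pos_left h7 hK0
        _ = ε := by field_simp; ring
    rintro _ ⟨s, hs, rfl⟩ _ ⟨t, ht, rfl⟩
    rcases le_total s t with hst | hst
    · rw [dist_comm]
      exact key s t hst hs ht
    · exact key t s hst ht hs
  obtain ⟨y, hy⟩ := CompleteSpace.complete hcau
  have hy : Tendsto (fun s => ψ (c s).proj) (𝓝[<] σ) (𝓝 y) := hy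
  have hyr : y ∈ Metric.ball y₀ r := by
    have h1 : Dist.dist y (ψ (c 0).proj) ≤ K * (S.length c 0 1).toReal := by
      refine le_of_tendsto (hy.dist tendsto_const_nhds) ?_
      filter_upwards [hev] with s hs
      refine (hdist 0 s le_rfl hs.1 hs.2).trans (mul_le_mul_of_nonneg_left ?_ hK0.le)
      have h2 : ℓ s ≤ (S.length c 0 1).toReal :=
        ENNReal.toReal_mono (hl.trans_le le_top).ne (lintegral_mono_set (hsub s))
      have h3 : 0 ≤ ℓ 0 := ENNReal.toReal_nonneg
      linarith
    have h2 : K * (S.length c 0 1).toReal < r / 2 := by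
      have := (ENNReal.lt_ofReal_iff_toReal_lt (hl.trans_le le_top).ne).1 hl
      calc _ < K * (r / (2 * K)) := mul_lt_mul_of_pos_left this hK0
        _ = r / 2 := by field_simp
    rw [Metric.mem_ball]
    linarith [dist_triangle y (ψ (c 0).proj) y₀]
  have hyt : y ∈ ψ.target := (hr hyr).1
  have h1 : Tendsto (fun s => (c s).proj) (𝓝[<] σ) (𝓝 (ψ.symm y)) := by
    refine ((ψ.continuousAt_symm hyt).tendsto.comp hy).congr' ?_
    filter_upwards [hev] with s hs
    exact ψ.left_inv (hin s hs.1 hs.2).1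
  have h2 : Tendsto (fun s => (c s).proj) (𝓝[<] σ) (𝓝 (c σ).proj) := by
    refine (hc.continuousOn σ hσ).mono_left (nhdsWithin_le_of_mem ?_)
    filter_upwards [hev] with s hs
    exact ⟨hs.1, hs.2.le.trans hσ.2⟩
  -- As $M$ is Hausdorff, the limit found in the chart is the actual position at $\sigma$, which is
  -- therefore still in $V$.
  have h3 := tendsto_nhds_unique h2 h1
  refine hσV ?_
  change (c σ).proj ∈ V
  rw [h3]
  refine ⟨ψ.map_target hyt, ?_⟩
  rw [mem_preimage, ψ.right_inv hyt]
  exact hyr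

end SubRiemannianStructure

/-! ### Projections of Hamiltonian solutions are horizontal. -/

theorem _root_.ContinuousOn.memLp_Icc {V : Type*} [NormedAddCommGroup V] {f : ℝ → V} {a b : ℝ}
    (hf : ContinuousOn f (Icc a b)) (p : ℝ≥0∞) : MemLp f p (volume.restrict (Icc a b)) := by
  obtain ⟨C, hC⟩ := isCompact_Icc.exists_bound_of_continuousOn hf
  exact MemLp.of_bound hf.aestronglyMeasurable_Icc C
    (ae_restrict_of_forall_mem measurableSet_Icc hC)

namespace SubRiemannianStructure

variable {B : Type*} [NormedAddCommGroup B] [NormedSpace ℝ B]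
  {M : Type*} [TopologicalSpace M] [ChartedSpace B M] [IsManifold 𝓘(ℝ, B) ∞ M]
  {F : Type*} [NormedAddCommGroup F] [NormedSpace ℝ F]
  {E : M → Type*} [TopologicalSpace (TotalSpace F E)]
  [∀ q, TopologicalSpace (E q)] [∀ q, AddCommGroup (E q)] [∀ q, Module ℝ (E q)]
  [∀ q, IsTopologicalAddGroup (E q)] [∀ q, ContinuousSMul ℝ (E q)]
  [FiberBundle F E] [VectorBundle ℝ F E] [ContMDiffVectorBundle ∞ F E 𝓘(ℝ, B)]
  {S : SubRiemannianStructure B M F E} {x₀ : M} {c : ℝ → TotalSpace F E}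

/-- With a continuous control the velocity is continuous, and the weak formulation reduces to the
fundamental theorem of calculus in each chart. -/
theorem isHorizontalOn_of_hasMFDerivWithinAt [CompleteSpace B] {a b : ℝ}
    (hc : ContinuousOn c (Icc a b))
    (hd : ∀ s ∈ Icc a b, HasMFDerivWithinAt 𝓘(ℝ, ℝ) 𝓘(ℝ, B) (fun t => (c t).proj) (Icc a b) s
      ((1 : ℝ →L[ℝ] ℝ).smulRight (S.anchor (c s).proj (c s).snd))) :
    S.IsHorizontalOn c a b := by
  have hproj : ContinuousOn (fun t => (c t).proj) (Icc a b) :=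
    (FiberBundle.continuous_proj F E).comp_continuousOn hc
  have hvel : ∀ (x : M) (s t : ℝ), a ≤ s → s ≤ t → t ≤ b →
      (∀ r ∈ Icc s t, (c r).proj ∈ (chartAt B x).source) →
      ContinuousOn (fun r => (mfderiv 𝓘(ℝ, B) 𝓘(ℝ, B) (chartAt B x) (c r).proj
        (S.anchor (c r).proj (c r).snd) : B)) (Icc s t) := by
    intro x s t hs hst ht h
    have h1 : ContinuousOn (fun r => TotalSpace.mk' B (E := TangentSpace 𝓘(ℝ, B))
        (c r).proj (S.anchor (c r).proj (c r).snd)) (Icc s t) := by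
      intro r hr
      have hsub : Icc s t ⊆ Icc a b := Icc_subset_Icc hs ht
      exact ContinuousWithinAt.clm_bundle_apply (F₁ := F) (E₁ := E)
        (b := fun r => (c r).proj) (ϕ := fun r => S.anchor (c r).proj) (v := fun r => (c r).snd)
        (S.contMDiff_anchor.continuous.continuousAt.comp_continuousWithinAt
          (hproj.mono hsub r hr)) (hc.mono hsub r hr)
    have h2 := (((trivializationAt B (TangentSpace 𝓘(ℝ, B)) x).continuousOn_toFun.comp h1
      fun r hr => h r hr).snd)
    refine h2.congr fun r hr => ?_
    rw [mfderiv_chartAt_eq_tangentCoordChange (h r hr)]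
    rfl
  refine ⟨hproj, ?_, fun x s t hs hst ht h => (hvel x s t hs hst ht h).memLp_Icc 2, ?_⟩
  · intro x s t hs hst ht h
    refine ContinuousOn.memLp_Icc ?_ 2
    exact ((trivializationAt F E x).continuousOn_toFun.comp (hc.mono (Icc_subset_Icc hs ht))
      fun r hr => (trivializationAt F E x).mem_source.2 (h r hr)).snd
  · intro x s t hs hst ht h
    have hder : ∀ r ∈ Icc s t, HasDerivWithinAt (fun r => chartAt B x (c r).proj)
        (mfderiv 𝓘(ℝ, B) 𝓘(ℝ, B) (chartAt B x) (c r).proj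
          (S.anchor (c r).proj (c r).snd) : B) (Icc s t) r := by
      intro r hr
      have h1 := (mdifferentiableAt_atlas (I := 𝓘(ℝ, B)) (chart_mem_atlas B x)
        (h r hr)).hasMFDerivAt
      have h2 := HasMFDerivAt.comp_hasMFDerivWithinAt r h1
        ((hd r (Icc_subset_Icc hs ht hr)).mono (Icc_subset_Icc hs ht))
      have h3 : ∀ w : B, (∀ a : ℝ, mfderiv 𝓘(ℝ, B) 𝓘(ℝ, B) (chartAt B x) (c r).proj
          (a • S.anchor (c r).proj (c r).snd) = a • w) →
          HasDerivWithinAt (fun r => chartAt B x (c r).proj) w (Icc s t) r := by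
        intro w hw
        have h4 := (HasFDerivWithinAt.congr_fderiv (hasMFDerivWithinAt_iff_hasFDerivWithinAt.1 h2)
          (g' := (1 : ℝ →L[ℝ] ℝ).smulRight w) (ContinuousLinearMap.ext hw)).hasDerivWithinAt
        rwa [ContinuousLinearMap.smulRight_apply, one_apply_eq_self, one_smul] at h4
      exact h3 _ fun a => map_smul _ a _
    refine (intervalIntegral.integral_eq_sub_of_hasDeriv_right (a := s) (b := t)
      (f := fun r => chartAt B x (c r).proj) ?_ ?_ ?_).symm
    · rw [uIcc_of_le hst]
      exact fun r hr => (hder r hr).continuousWithinAt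
    · rw [min_eq_left hst, max_eq_right hst]
      intro r hr
      exact ((hder r (Ioo_subset_Icc_self hr)).hasDerivAt
        (Icc_mem_nhds hr.1 hr.2)).hasDerivWithinAt
    · exact ContinuousOn.intervalIntegrable (by rw [uIcc_of_le hst]; exact hvel x s t hs hst ht h)

end SubRiemannianStructure

namespace SubRiemannianStructure

variable {B : Type*} [NormedAddCommGroup B] [NormedSpace ℝ B]
  {M : Type*} [TopologicalSpace M] [ChartedSpace B M] [IsManifold 𝓘(ℝ, B) ∞ M]
  {F : Type*} [NormedAddCommGroup F] [NormedSpace ℝ F]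
  {E : M → Type*} [TopologicalSpace (TotalSpace F E)]
  [∀ q, TopologicalSpace (E q)] [∀ q, AddCommGroup (E q)] [∀ q, Module ℝ (E q)]
  [∀ q, IsTopologicalAddGroup (E q)] [∀ q, ContinuousSMul ℝ (E q)]
  [FiberBundle F E] [VectorBundle ℝ F E] [ContMDiffVectorBundle ∞ F E 𝓘(ℝ, B)]
  {S : SubRiemannianStructure B M F E} [CompleteSpace F] (hS : S.IsStrong)
include hS

theorem continuous_smul_normalControl (T : ℝ) :
    Continuous (fun z : CotangentBundle B M =>
      (⟨z.proj, T • S.normalControl z⟩ : TotalSpace F E)) := by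
  have hc : Continuous (fun z : CotangentBundle B M => z.proj) :=
    FiberBundle.continuous_proj _ _
  rw [continuous_iff_continuousAt]
  intro z₀
  rw [FiberBundle.continuousAt_totalSpace]
  refine ⟨hc.continuousAt, ?_⟩
  have hz₀ : cotangentCoord z₀.proj z₀ ∈ {w | w.1 ∈ S.localDomain z₀.proj} :=
    chartAt_mem_localDomain (S := S) (mem_chart_source B z₀.proj)
      (FiberBundle.mem_baseSet_trivializationAt' z₀.proj)
  have h1 := ((isLocalModel (x₀ := z₀.proj) hS).contDiffAt_localControl hz₀).continuousAt
  rw [← extChartAt_cotangent_apply] at h1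
  refine ((h1.comp (continuousAt_extChartAt (I := cotangentModel B) z₀)).const_smul T).congr ?_
  filter_upwards [hc.continuousAt.eventually_mem (chart_source_mem_nhds B z₀.proj),
    hc.continuousAt.eventually_mem ((trivializationAt F E z₀.proj).open_baseSet.mem_nhds
      (FiberBundle.mem_baseSet_trivializationAt' z₀.proj))] with z hz hz'
  rw [Pi.smul_apply, Function.comp_apply, extChartAt_cotangent_apply,
    ← trivializationAt_normalControl hS hz hz']
  exact (((trivializationAt F E z₀.proj).continuousLinearEquivAt ℝ z.proj hz').map_smul T
    (S.normalControl z)).symm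

/-- In the chart centred at `z` the tangent coordinate change at `z` is the identity, so $\dot
q=\xi_qu$ can be read off the coordinate field. -/
theorem symplecticGradient_fst (z : CotangentBundle B M) :
    (symplecticGradient S.normalHamiltonian z : B × (B →L[ℝ] ℝ)).1 =
      (S.anchor z.proj (S.normalControl z) : B) := by
  have h1 := mem_chart_source B z.proj
  have h2 := FiberBundle.mem_baseSet_trivializationAt' (F := F) (E := E) z.proj
  have h3 := tangentCoordChange_symplecticGradient hS (z₀ := z) (z := z) h1 h2
  have h4 := (tangentCoordChange_self (mem_extChartAt_source z)).symm.trans h3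
  rw [h4, localField, ← trivializationAt_normalControl hS h1 h2]
  refine (localAnchor_apply h1 h2 _).trans ?_
  rw [mfderiv_chartAt_eq_tangentCoordChange h1]
  exact tangentCoordChange_self (mem_extChartAt_source z.proj)

/-- The trajectory of a solution of the Hamiltonian equation follows the normal control. -/
theorem hasMFDerivWithinAt_proj {γ : ℝ → CotangentBundle B M} {J : Set ℝ}
    (hγ : IsMIntegralCurveOn γ (symplecticGradient S.normalHamiltonian) J) {t : ℝ} (ht : t ∈ J) :
    HasMFDerivWithinAt 𝓘(ℝ, ℝ) 𝓘(ℝ, B) (fun t => (γ t).proj) J t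
      ((1 : ℝ →L[ℝ] ℝ).smulRight (S.anchor (γ t).proj (S.normalControl (γ t)))) := by
  obtain ⟨h1, h2⟩ := hγ t ht
  refine ⟨(FiberBundle.continuous_proj _ _).continuousAt.comp_continuousWithinAt h1, ?_⟩
  have h3 := (ContinuousLinearMap.fst ℝ B (B →L[ℝ] ℝ)).hasFDerivAt.comp_hasFDerivWithinAt _ h2
  refine HasFDerivWithinAt.congr_fderiv h3 (ContinuousLinearMap.ext fun a => ?_)
  exact congrArg (fun w : B => (a : ℝ) • w) (symplecticGradient_fst hS (γ t))

/-- Serves twice: with `T = 1`, `t₀ = 0` for the projected solution itself, and with `T = t₁ - t₀`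
to turn a piece of it into a competitor on $[0,1]$ for the distance. -/
theorem isHorizontalOn_comp_affine [CompleteSpace B] {γ : ℝ → CotangentBundle B M} {J : Set ℝ}
    (hγ : IsMIntegralCurveOn γ (symplecticGradient S.normalHamiltonian) J) {t₀ T a b : ℝ}
    (hJ : ∀ s ∈ Icc a b, s * T + t₀ ∈ J) :
    S.IsHorizontalOn (fun s => (⟨(γ (s * T + t₀)).proj, T • S.normalControl (γ (s * T + t₀))⟩ :
      TotalSpace F E)) a b := by
  have haff : ∀ s, HasFDerivWithinAt (fun s : ℝ => s * T + t₀)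
      ((1 : ℝ →L[ℝ] ℝ).smulRight T) (Icc a b) s := fun s =>
    (((hasDerivAt_id s).mul_const T).add_const t₀).hasDerivWithinAt.hasFDerivWithinAt.congr_fderiv
      (by ext; simp)
  refine isHorizontalOn_of_hasMFDerivWithinAt ?_ fun s hs => ?_
  · exact (continuous_smul_normalControl hS T).comp_continuousOn
      (hγ.continuousOn.comp (by fun_prop) hJ)
  · have h1 := HasMFDerivWithinAt.comp s (hasMFDerivWithinAt_proj hS hγ (hJ s hs))
      (haff s).hasMFDerivWithinAt hJ
    have key : ∀ (a : ℝ) (q : M) (u : E q),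
        (a * T) • S.anchor q u = a • S.anchor q (T • u) := fun a q u => by
      rw [map_smul, mul_smul]
    exact HasMFDerivWithinAt.congr_mfderiv h1 (ContinuousLinearMap.ext fun a => key a _ _)

end SubRiemannianStructure

/-! ### Local minimality: the projections are geodesics. -/

namespace SubRiemannianStructure

variable {B : Type*} [NormedAddCommGroup B] [NormedSpace ℝ B]
  {M : Type*} [TopologicalSpace M] [ChartedSpace B M] [IsManifold 𝓘(ℝ, B) ∞ M]
  {F : Type*} [NormedAddCommGroup F] [NormedSpace ℝ F]
  {E : M → Type*} [TopologicalSpace (TotalSpace F E)]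
  [∀ q, TopologicalSpace (E q)] [∀ q, AddCommGroup (E q)] [∀ q, Module ℝ (E q)]
  [∀ q, IsTopologicalAddGroup (E q)] [∀ q, ContinuousSMul ℝ (E q)]
  [FiberBundle F E] [VectorBundle ℝ F E] [ContMDiffVectorBundle ∞ F E 𝓘(ℝ, B)]
  {S : SubRiemannianStructure B M F E}

theorem length_eq_of_metric_eq {c : ℝ → TotalSpace F E} {a b e : ℝ}
    (h : ∀ s ∈ Icc a b, S.metric (c s).proj (c s).snd (c s).snd = e) :
    S.length c a b = ENNReal.ofReal (√e * (b - a)) := by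
  rw [length, setLIntegral_congr_fun (g := fun _ => ENNReal.ofReal √e) measurableSet_Icc
    fun s hs => by simp only [h s hs], setLIntegral_const, Real.volume_Icc,
    ENNReal.ofReal_mul (Real.sqrt_nonneg _)]

theorem metric_normalControl (z : CotangentBundle B M) :
    S.metric z.proj (S.normalControl z) (S.normalControl z) = 2 * S.normalHamiltonian z := by
  rw [normalHamiltonian]
  ring

variable [CompleteSpace F] (hS : S.IsStrong)
include hS

/-- A solution of the Hamiltonian equation, in coordinates. -/
theorem hasDerivAt_cotangentCoord {γ : ℝ → CotangentBundle B M} {J : Set ℝ}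
    (hγ : IsMIntegralCurveOn γ (symplecticGradient S.normalHamiltonian) J) {t s : ℝ}
    (hs : J ∈ 𝓝 s) (h : (γ s).proj ∈ (chartAt B (γ t).proj).source)
    (h' : (γ s).proj ∈ (trivializationAt F E (γ t).proj).baseSet) :
    HasDerivAt (fun s => cotangentCoord (γ t).proj (γ s))
      (localField (S.localAnchor (γ t).proj) (S.localMetric (γ t).proj)
        (cotangentCoord (γ t).proj (γ s))) s := by
  have h1 := (hγ.hasDerivWithinAt (t₀ := t) (mem_of_mem_nhds hs) (by
    rw [extChartAt_cotangent_source]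
    exact h)).hasDerivAt hs
  have h2 : extChartAt (cotangentModel B) (γ t) ∘ γ = fun s => cotangentCoord (γ t).proj (γ s) :=
    funext fun s => extChartAt_cotangent_apply _ _
  rw [h2] at h1
  exact h1.congr_deriv (tangentCoordChange_symplecticGradient hS h h')

variable [CompleteSpace B] [T2Space M]

/-- Near each point of its domain, a solution of the Hamiltonian equation has constant Hamiltonian
and is at least as short as every horizontal curve with the same end points. -/
theorem exists_forall_le_length {γ : ℝ → CotangentBundle B M} {t ε₀ : ℝ} (hε₀ : 0 < ε₀)
    (hγ : IsMIntegralCurveOn γ (symplecticGradient S.normalHamiltonian) (Ioo (t - ε₀) (t + ε₀))) :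
    ∃ ε > 0, ε ≤ ε₀ ∧
      (∀ s ∈ Ioo (t - ε) (t + ε), S.normalHamiltonian (γ s) = S.normalHamiltonian (γ t)) ∧
      ∀ t₀ t₁, t - ε < t₀ → t₀ < t₁ → t₁ < t + ε → ∀ c : ℝ → TotalSpace F E,
        S.IsHorizontalOn c 0 1 → (c 0).proj = (γ t₀).proj → (c 1).proj = (γ t₁).proj →
        ENNReal.ofReal (√(2 * S.normalHamiltonian (γ t)) * (t₁ - t₀)) ≤ S.length c 0 1 := by
  set x₀ := (γ t).proj with hx₀
  set Γ : ℝ → B × (B →L[ℝ] ℝ) := fun s => cotangentCoord x₀ (γ s) with hΓ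
  have hm : IsLocalModel (S.localAnchor x₀) (S.localMetric x₀) (S.localDomain x₀) :=
    isLocalModel hS
  have hx₀s := mem_chart_source B x₀
  have hx₀b := FiberBundle.mem_baseSet_trivializationAt' (F := F) (E := E) x₀
  have ht : t ∈ Ioo (t - ε₀) (t + ε₀) := ⟨by linarith, by linarith⟩
  obtain ⟨r, hr, δ, hδ, K, hK, hU, hξ, hmin⟩ := hm.exists_sqrt_mul_le_integral (z₀ := Γ t)
    (chartAt_mem_localDomain (S := S) hx₀s hx₀b)
  have hcγ : ContinuousAt γ t := hγ.continuousOn.continuousAt (isOpen_Ioo.mem_nhds ht)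
  have hcΓ : ContinuousAt Γ t :=
    (hasDerivAt_cotangentCoord hS hγ (isOpen_Ioo.mem_nhds ht) hx₀s hx₀b).continuousAt
  have hcp : ContinuousAt (fun s => (γ s).proj) t :=
    (FiberBundle.continuous_proj _ _).continuousAt.comp hcγ
  obtain ⟨ε₁, hε₁, hball⟩ := Metric.eventually_nhds_iff_ball.1
    ((hcp.eventually_mem (chart_source_mem_nhds B x₀)).and
      (hcΓ.eventually_mem (Metric.ball_mem_nhds _ (half_pos hr))))
  set e := √(2 * S.normalHamiltonian (γ t)) with he
  have he0 : 0 ≤ e := Real.sqrt_nonneg _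
  -- Two times in the window differ by less than $2\varepsilon$: the third entry keeps this below
  -- $\delta$, the fourth makes the length of the extremal at most $r/(2K)$, the confinement
  -- threshold.
  set ε := min (min ε₀ ε₁) (min (δ / 2) (r / (4 * K * (e + 1)))) with hε
  have hε0 : 0 < ε := by
    refine lt_min (lt_min hε₀ hε₁) (lt_min (by positivity) (by positivity))
  have hεε₀ : ε ≤ ε₀ := (min_le_left _ _).trans (min_le_left _ _)
  have hεε₁ : ε ≤ ε₁ := (min_le_left _ _).trans (min_le_right _ _)
  have hεδ : ε ≤ δ / 2 := (min_le_right _ _).trans (min_le_left _ _)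
  have hεr : ε ≤ r / (4 * K * (e + 1)) := (min_le_right _ _).trans (min_le_right _ _)
  have hsrc : ∀ s ∈ Ioo (t - ε) (t + ε), (γ s).proj ∈ (chartAt B x₀).source := fun s hs =>
    (hball s (by rw [Real.ball_eq_Ioo]; exact ⟨by linarith [hs.1], by linarith [hs.2]⟩)).1
  have hΓr : ∀ s ∈ Ioo (t - ε) (t + ε), Γ s ∈ Metric.ball (Γ t) (r / 2) := fun s hs =>
    (hball s (by rw [Real.ball_eq_Ioo]; exact ⟨by linarith [hs.1], by linarith [hs.2]⟩)).2
  have hfst : ∀ s ∈ Ioo (t - ε) (t + ε), Dist.dist (Γ s).1 (Γ t).1 < r / 2 := fun s hs =>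
    (le_max_left _ _).trans_lt (hΓr s hs)
  have hdom : ∀ s ∈ Ioo (t - ε) (t + ε), (Γ s).1 ∈ S.localDomain x₀ := fun s hs =>
    hU (by rw [Metric.mem_ball]; linarith [hfst s hs])
  have hbase : ∀ s ∈ Ioo (t - ε) (t + ε), (γ s).proj ∈ (trivializationAt F E x₀).baseSet :=
    fun s hs => mem_of_chartAt_mem_localDomain (hsrc s hs) (hdom s hs)
  have hder : ∀ s ∈ Ioo (t - ε) (t + ε), HasDerivAt Γ
      (localField (S.localAnchor x₀) (S.localMetric x₀) (Γ s)) s := fun s hs =>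
    hasDerivAt_cotangentCoord hS hγ
      (Ioo_mem_nhds (by linarith [hs.1]) (by linarith [hs.2])) (hsrc s hs) (hbase s hs)
  have hham : ∀ s ∈ Ioo (t - ε) (t + ε), S.normalHamiltonian (γ s) =
      localHamiltonian (S.localAnchor x₀) (S.localMetric x₀) (Γ s) := fun s hs =>
    normalHamiltonian_eq_localHamiltonian hS (hsrc s hs) (hbase s hs)
  have htε : t ∈ Ioo (t - ε) (t + ε) := ⟨by linarith, by linarith⟩
  have hen : ∀ s ∈ Ioo (t - ε) (t + ε),
      S.normalHamiltonian (γ s) = S.normalHamiltonian (γ t) := by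
    intro s hs
    rw [hham s hs, hham t htε]
    rcases le_total t s with hts | hts
    · have hsub : Icc t s ⊆ Ioo (t - ε) (t + ε) := ordConnected_Ioo.out htε hs
      exact hm.localHamiltonian_eq_of_hasDerivAt (fun τ hτ => hdom τ (hsub hτ))
        (fun τ hτ => hder τ (hsub hτ)) (right_mem_Icc.2 hts)
    · have hsub : Icc s t ⊆ Ioo (t - ε) (t + ε) := ordConnected_Ioo.out hs htε
      exact (hm.localHamiltonian_eq_of_hasDerivAt (fun τ hτ => hdom τ (hsub hτ))
        (fun τ hτ => hder τ (hsub hτ)) (right_mem_Icc.2 hts)).symm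
  refine ⟨ε, hε0, hεε₀, hen, fun t₀ t₁ h₀ h₀₁ h₁ c hc hc0 hc1 => ?_⟩
  have ht₀ : t₀ ∈ Ioo (t - ε) (t + ε) := ⟨h₀, h₀₁.trans h₁⟩
  have ht₁ : t₁ ∈ Ioo (t - ε) (t + ε) := ⟨h₀.trans h₀₁, h₁⟩
  have hsub : Icc t₀ t₁ ⊆ Ioo (t - ε) (t + ε) := ordConnected_Ioo.out ht₀ ht₁
  -- Only a competitor shorter than the extremal has to be excluded; it is then short enough to be
  -- confined to the chart ball, where the coordinate estimate applies.
  by_contra! hlt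
  have hsmall : e * (t₁ - t₀) ≤ r / (2 * K) := by
    have h1 : t₁ - t₀ ≤ 2 * (r / (4 * K * (e + 1))) := by linarith
    calc e * (t₁ - t₀) ≤ (e + 1) * (2 * (r / (4 * K * (e + 1)))) :=
          mul_le_mul (by linarith) h1 (by linarith) (by linarith)
      _ = r / (2 * K) := by field_simp; ring
  have hin := hc.mem_ball_of_length_lt hU hr hK hξ (by rw [hc0]; exact hsrc t₀ ht₀)
    (by rw [hc0]; exact hfst t₀ ht₀) (hlt.trans_le (ENNReal.ofReal_le_ofReal hsmall))
  have hb : ∀ s ∈ Icc (0 : ℝ) 1, (c s).proj ∈ (trivializationAt F E x₀).baseSet := fun s hs =>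
    mem_of_chartAt_mem_localDomain (hin s hs).1 (hU (hin s hs).2)
  have hint : ∀ s t, 0 ≤ s → s ≤ t → t ≤ 1 →
      chartAt B x₀ (c t).proj - chartAt B x₀ (c s).proj =
      ∫ τ in s..t, S.localAnchor x₀ (chartAt B x₀ (c τ).proj)
        (trivializationAt F E x₀ (c τ)).2 := fun s t hs hst ht =>
    hc.sub_eq_integral hs hst ht (fun τ hτ => (hin τ ⟨hs.trans hτ.1, hτ.2.trans ht⟩).1)
      fun τ hτ => hb τ ⟨hs.trans hτ.1, hτ.2.trans ht⟩
  have key := hmin t₀ t₁ h₀₁ (by linarith) Γ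
    (fun τ hτ => Metric.ball_subset_ball (by linarith) (hΓr τ (hsub hτ)))
    (fun τ hτ => hder τ (hsub hτ)) (fun s => chartAt B x₀ (c s).proj)
    (fun s => (trivializationAt F E x₀ (c s)).2) (fun s hs => (hin s hs).2)
    ((chartAt B x₀).continuousOn.comp hc.continuousOn fun s hs => (hin s hs).1)
    ((hc.memLp_control x₀ 0 1 le_rfl zero_le_one le_rfl hb).integrable (by norm_num))
    (fun s hs t ht => by
      rcases le_total s t with hst | hst
      · exact hint s t hs.1 hst ht.2
      · rw [intervalIntegral.integral_symm, ← hint t s ht.1 hst hs.2, neg_sub])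
    (by simp only [hc0]; rfl) (by simp only [hc1]; rfl)
  rw [← hham t₀ ht₀, hen t₀ ht₀] at key
  rw [hc.length_eq hS (fun s hs => (hin s hs).1) hb] at hlt
  exact absurd (ENNReal.ofReal_le_ofReal key) (not_le.2 hlt)

/-- The solutions of the Hamiltonian equation project to geodesics. -/
theorem IsHamiltonianSolution.isGeodesicOn {γ : ℝ → CotangentBundle B M} {J : Set ℝ}
    (hγ : S.IsHamiltonianSolution γ J) :
    S.IsGeodesicOn (fun t => (⟨(γ t).proj, S.normalControl (γ t)⟩ : TotalSpace F E)) J := by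
  refine ⟨fun a b hab hJ => ?_, fun t ht => ?_⟩
  · have := isHorizontalOn_comp_affine hS (hγ.2.mono hJ) (t₀ := 0) (T := 1) (a := a) (b := b)
      (fun s hs => by simpa using hs)
    have h : ∀ s s' : ℝ, s' = s → (⟨(γ s').proj, (1 : ℝ) • S.normalControl (γ s')⟩ :
        TotalSpace F E) = ⟨(γ s).proj, S.normalControl (γ s)⟩ := by
      rintro s _ rfl
      rw [one_smul]
    rwa [funext fun s => h s (s * 1 + 0) (by simp)] at this
  -- If $t$ is an end point of $J$, the solution is first extended beyond it, since the local
  -- estimate needs an open interval around $t$.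
  obtain ⟨γ', ε₀, hε₀, hγ', heq⟩ :=
    hγ.2.exists_extension (contMDiff_symplecticGradient hS) hγ.1 ht
  obtain ⟨ε, hε, hεε₀, hen, hmin⟩ := exists_forall_le_length hS hε₀ hγ'
  refine ⟨ε, hε, fun t₀ ht₀ t₁ ht₁ h₀ h₀₁ h₁ => ?_⟩
  have hsub : Icc t₀ t₁ ⊆ Ioo (t - ε) (t + ε) :=
    fun s hs => ⟨h₀.trans_le hs.1, hs.2.trans_lt h₁⟩
  have heq' : ∀ s ∈ Icc t₀ t₁, γ' s = γ s := fun s hs =>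
    heq ⟨hγ.1.out ht₀ ht₁ hs, by linarith [(hsub hs).1], by linarith [(hsub hs).2]⟩
  have hmet : ∀ s ∈ Icc t₀ t₁, S.metric (γ s).proj (S.normalControl (γ s))
      (S.normalControl (γ s)) = 2 * S.normalHamiltonian (γ' t) := fun s hs => by
    rw [metric_normalControl, ← heq' s hs, hen s (hsub hs)]
  have hlen := length_eq_of_metric_eq (S := S)
    (c := fun t => (⟨(γ t).proj, S.normalControl (γ t)⟩ : TotalSpace F E)) hmet
  rw [hlen]
  refine le_antisymm ?_ ?_
  · refine le_iInf₂ fun c hc => ?_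
    rcases h₀₁.eq_or_lt with rfl | hlt
    · simp
    · exact hmin t₀ t₁ h₀ hlt h₁ c hc.1 (by rw [heq' _ ⟨le_rfl, h₀₁⟩]; exact hc.2.1)
        (by rw [heq' _ ⟨h₀₁, le_rfl⟩]; exact hc.2.2)
  · have hmem : ∀ s ∈ Icc (0 : ℝ) 1, s * (t₁ - t₀) + t₀ ∈ Icc t₀ t₁ := fun s hs => by
      constructor
      · nlinarith [hs.1]
      · nlinarith [hs.2]
    -- The extremal itself, reparametrized on $[0,1]$, is a competitor; by conservation of energy
    -- its speed is constant, so its length is $\sqrt{2h}\,(t_1-t_0)$.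
    refine (iInf₂_le (fun s : ℝ => (⟨(γ (s * (t₁ - t₀) + t₀)).proj,
      (t₁ - t₀) • S.normalControl (γ (s * (t₁ - t₀) + t₀))⟩ : TotalSpace F E))
      ⟨isHorizontalOn_comp_affine hS hγ.2 fun s hs => hγ.1.out ht₀ ht₁ (hmem s hs),
        by simp, by simp⟩).trans ?_
    rw [length_eq_of_metric_eq (e := (t₁ - t₀) ^ 2 * (2 * S.normalHamiltonian (γ' t)))
      fun s hs => ?_]
    · rw [Real.sqrt_mul (sq_nonneg _), Real.sqrt_sq (by linarith)]
      exact ENNReal.ofReal_le_ofReal (by linarith)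
    · simp only [map_smul, _root_.smul_apply, smul_eq_mul]
      rw [hmet _ (hmem s hs)]
      ring

end SubRiemannianStructure

end SubRiem

end

/-! ### The theorem. -/

open SubRiem.SubRiemannianStructure in
theorem mainTheorem3
    {B : Type*} [NormedAddCommGroup B] [NormedSpace ℝ B] [CompleteSpace B]
    {M : Type*} [TopologicalSpace M] [T2Space M] [ChartedSpace B M] [IsManifold 𝓘(ℝ, B) ∞ M]
    {F : Type*} [NormedAddCommGroup F] [NormedSpace ℝ F] [CompleteSpace F]
    {E : M → Type*} [TopologicalSpace (TotalSpace F E)]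
    [∀ q, TopologicalSpace (E q)] [∀ q, AddCommGroup (E q)] [∀ q, Module ℝ (E q)]
    [∀ q, IsTopologicalAddGroup (E q)] [∀ q, ContinuousSMul ℝ (E q)]
    [FiberBundle F E] [VectorBundle ℝ F E] [ContMDiffVectorBundle ∞ F E 𝓘(ℝ, B)]
    (S : SubRiem.SubRiemannianStructure B M F E) (hS : S.IsStrong) :
    -- the normal Hamiltonian is well defined on all of `T*M`, and smooth
    (∀ z : SubRiem.CotangentBundle B M,
      (∃! u : E z.proj, S.IsNormalControl z u) ∧
      S.IsNormalControl z (S.normalControl z) ∧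
      S.normalHamiltonian z = S.preHamiltonian z (S.normalControl z) ∧
      IsGreatest (range (S.preHamiltonian z)) (S.normalHamiltonian z)) ∧
    ContMDiff (SubRiem.cotangentModel B) 𝓘(ℝ, ℝ) ∞
      (S.normalHamiltonian : SubRiem.CotangentBundle B M → ℝ) ∧
    -- its symplectic gradient exists everywhere
    (∀ z : SubRiem.CotangentBundle B M,
      (∃! X, SubRiem.IsSymplecticGradient S.normalHamiltonian z X) ∧
      SubRiem.IsSymplecticGradient S.normalHamiltonian z
        (SubRiem.symplecticGradient S.normalHamiltonian z)) ∧
    -- for every initial covector there is a unique maximal solution; it is defined on an open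
    -- interval and extends every other solution
    (∀ z₀ : SubRiem.CotangentBundle B M,
      ∃ (γ : ℝ → SubRiem.CotangentBundle B M) (J : Set ℝ),
        IsOpen J ∧ S.IsMaximalSolution z₀ γ J ∧
        (∀ γ' J', S.IsMaximalSolution z₀ γ' J' → J' = J ∧ EqOn γ' γ J) ∧
        (∀ γ' J', S.IsHamiltonianSolution γ' J' → 0 ∈ J' → γ' 0 = z₀ →
          J' ⊆ J ∧ EqOn γ' γ J')) ∧
    -- every solution projects to a geodesic, with control `u(q, p)`
    (∀ (γ : ℝ → SubRiem.CotangentBundle B M) (J : Set ℝ), S.IsHamiltonianSolution γ J →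
      S.IsGeodesicOn (fun t => (⟨(γ t).proj, S.normalControl (γ t)⟩ : TotalSpace F E)) J) := by
  refine ⟨fun z => ⟨?_, isNormalControl_normalControl hS z,
    normalHamiltonian_eq_preHamiltonian hS z, isGreatest_normalHamiltonian hS z⟩,
    contMDiff_normalHamiltonian hS, fun z => ⟨?_, isSymplecticGradient_symplecticGradient hS z⟩,
    fun z₀ => ?_, fun γ J h => h.isGeodesicOn hS⟩
  · exact ⟨_, isNormalControl_normalControl hS z,
      fun u hu => hu.eq (isNormalControl_normalControl hS z)⟩
  · exact ⟨_, isSymplecticGradient_symplecticGradient hS z,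
      fun X hX => hX.eq (isSymplecticGradient_symplecticGradient hS z)⟩
  · obtain ⟨γ, J, hJ, hoc, hγ, h0, hz₀, hmax⟩ :=
      SubRiem.exists_maximal_isMIntegralCurveOn (contMDiff_symplecticGradient hS) 0 z₀
    have hext : ∀ γ' J', S.IsHamiltonianSolution γ' J' → 0 ∈ J' → γ' 0 = z₀ →
        J' ⊆ J ∧ EqOn γ' γ J' := fun γ' J' h => hmax γ' J' h.1 h.2
    refine ⟨γ, J, hJ, ⟨⟨hoc, hγ⟩, h0, hz₀, fun γ' J' h hJJ heq => ?_⟩, ?_, hext⟩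
    · exact ((hext γ' J' h (hJJ h0) ((heq h0).trans hz₀)).1).antisymm hJJ
    · rintro γ' J' ⟨h1, h2, h3, h4⟩
      obtain ⟨hs, he⟩ := hext γ' J' h1 h2 h3
      -- Any other maximal solution is a restriction of the largest one, so its own maximality
      -- forces the two domains to coincide.
      obtain rfl := h4 γ J ⟨hoc, hγ⟩ hs he.symm
      exact ⟨rfl, he⟩
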